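/- Conventions. Let $k\ge 2$. A $k$-uniform hypergraph $G=(V,E)$ consists of a finite vertex set $V$ and a set $E$ of $k$-element subsets of $V$, called edges; the degree $d_v$ of a vertex $v$ is the number of edges containing $v$, and $v$ is pendent if $d_v=1$. A path of length $l\ge 0$ is an alternating sequence $v_1,e_1,v_2,\ldots,e_l,v_{l+1}$ of distinct vertices and distinct edges with $v_i,v_{i+1}\in e_i$ for all $i$; a cycle is such a sequence with $l\ge 2$ in which $v_1=v_{l+1}$ and otherwise the vertices, and all the edges, are distinct. A supertree is a hypergraph on at least one vertex in which any two vertices are joined by a path and which contains no cycle. The signless Laplacian tensor of a $k$-uniform hypergraph $G$ on $n$ vertices is $\mathcal Q(G)=\mathcal D(G)+\mathcal A(G)$, where $\mathcal D(G)$ is the diagonal tensor of order $k$ and dimension $n$ with diagonal entries $d_v$, and $\mathcal A(G)$ has the entry $\frac1{(k-1)!}$ at $(i_1,\ldots,i_k)$ if $\{i_1,\ldots,i_k\}\in E$ and $0$ otherwise. A number $\lambda\in\mathbb C$ is an eigenvalue of a tensor $\mathcal T=(t_{i_1\cdots i_k})$ if there is $x\in\mathbb C^n\setminus\{0\}$ with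 $\sum_{i_2,\ldots,i_k}t_{ii_2\cdots i_k}x_{i_2}\cdots x_{i_k}=\lambda x_i^{k-1}$ for all $i$. The signless Laplacian spectral radius of $G$ is the largest modulus of an eigenvalue of $\mathcal Q(G)$. Let $G$ be a $k$-uniform supertree with root $v_0$, and let $h(v)$ be the distance (length of a shortest path) from $v_0$ to $v$. A (strict) well-ordering $\prec$ of $V$ is a BFS-ordering if (a) $u\prec v$ implies $h(u)\le h(v)$; (b) $u\prec v$ implies $d_u\ge d_v$; (c) if $u,u_1\in e_1\in E$, $v,v_1\in e_2\in E$, $u\prec v$, $h(u)=h(u_1)+1$ and $h(v)=h(v_1)+1$, then $u_1\prec v_1$ or $u_1=v_1$; (d) if $e=\{u_1,\ldots,u_k\}\in E$ with $u_1\prec u_2\prec\cdots\prec u_k$, then there is no $v\in V\setminus e$ with $u_i\prec v\prec u_{i+1}$ for some $2\le i\le k-1$. A BFS-supertree is a supertree that has a BFS-ordering for some choice of the root. **Theorem.** Let $k\ge 2$, let $n\ge 1$ be such that $k-1$ divides $n-1$, and let $n-\frac{n-1}{k-1}+1\le q\le n-1$. There is a $k$-uniform BFS-supertree $G^*$ on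 $n$ vertices with degree sequence $$\Bigl(q+1+\tfrac{n-1}{k-1}-n,\ \underbrace{2,\ldots,2}_{n-q-1},\ \underbrace{1,\ldots,1}_{q}\Bigr),$$ and every such $G^*$ is, up to isomorphism, the unique maximizer of the signless Laplacian spectral radius among all $k$-uniform supertrees with $n$ vertices and exactly $q$ pendent vertices: $G^*$ is one of these supertrees, and every supertree $H$ among them has signless Laplacian spectral radius at most that of $G^*$, with equality if and only if $H\cong G^*$. -/

import Mathlib

noncomputable section

/-- A tensor of order `k` over `ℂ` whose indices range over `V` (so of dimension `|V|`). -/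
abbrev CTensor (k : ℕ) (V : Type*) := (Fin k → V) → ℂ

namespace CTensor

variable {k : ℕ} {V : Type*} [Fintype V]

open Classical in
/-- The vector `A x^{k-1}`: its `i`-th entry is
`∑_{i₂,…,i_k} a_{i i₂ … i_k} x_{i₂} ⋯ x_{i_k}`, i.e. the sum over all index tuples `f` whose
first index is `i`, with the product over all the other positions. -/
def applyVec (A : CTensor k V) (x : V → ℂ) (i : V) : ℂ :=
  ∑ f : Fin k → V with (∀ j : Fin k, j.val = 0 → f j = i),
    A f * ∏ j : Fin k with j.val ≠ 0, x (f j)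

/-- `lam` is an eigenvalue of `A`: `A x^{k-1} = lam x^{[k-1]}` has a non-zero complex solution. -/
def IsEigenvalue (A : CTensor k V) (lam : ℂ) : Prop :=
  ∃ x : V → ℂ, x ≠ 0 ∧ ∀ i, A.applyVec x i = lam * x i ^ (k - 1)

/-- The spectral radius: the largest modulus of an eigenvalue. -/
def spectralRadius (A : CTensor k V) : ℝ :=
  sSup {r : ℝ | ∃ lam : ℂ, A.IsEigenvalue lam ∧ r = ‖lam‖}

end CTensor

namespace Hypergraph

variable {V W : Type*}

/-- Every edge has exactly `k` vertices. -/
def IsUniform (G : Hypergraph V) (k : ℕ) : Prop :=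
  ∀ e ∈ G.edgeSet, e.ncard = k

/-- The degree of `v`: the number of edges containing `v`. -/
def degree (G : Hypergraph V) (v : V) : ℕ :=
  {e | e ∈ G.edgeSet ∧ v ∈ e}.ncard

/-- The alternating sequence `v 0, e 0, v 1, …, e (l-1), v l` consists of vertices and edges of `G`,
each edge containing the vertices before and after it. -/
def IsAlternating (G : Hypergraph V) (l : ℕ) (v : Fin (l + 1) → V) (e : Fin l → Set V) : Prop :=
  (∀ i, v i ∈ G.vertexSet) ∧
    ∀ i : Fin l, e i ∈ G.edgeSet ∧ v i.castSucc ∈ e i ∧ v i.succ ∈ e i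

/-- A path of length `l`: distinct vertices and distinct edges. -/
def IsPath (G : Hypergraph V) (l : ℕ) (v : Fin (l + 1) → V) (e : Fin l → Set V) : Prop :=
  G.IsAlternating l v e ∧ Function.Injective v ∧ Function.Injective e

/-- There is a path of length `l` from `a` to `b`. -/
def HasPath (G : Hypergraph V) (l : ℕ) (a b : V) : Prop :=
  ∃ v e, G.IsPath l v e ∧ v 0 = a ∧ v (Fin.last l) = b

/-- A cycle of length `l ≥ 2`: a closed alternating sequence whose vertices (apart from the
coincidence of the first and the last one) and edges are distinct. -/
def IsCycle (G : Hypergraph V) (l : ℕ) (v : Fin (l + 1) → V) (e : Fin l → Set V) : Prop :=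
  2 ≤ l ∧ G.IsAlternating l v e ∧ v 0 = v (Fin.last l) ∧
    Function.Injective (fun i : Fin l => v i.castSucc) ∧ Function.Injective e

/-- Any two vertices are joined by a path. -/
def IsConnected (G : Hypergraph V) : Prop :=
  G.vertexSet.Nonempty ∧ ∀ a ∈ G.vertexSet, ∀ b ∈ G.vertexSet, ∃ l, G.HasPath l a b

/-- There are no cycles. -/
def IsAcyclic (G : Hypergraph V) : Prop :=
  ∀ l v e, ¬ G.IsCycle l v e

/-- `G` is a `k`-uniform supertree with vertex set the whole type `V`. -/
structure IsSupertree (G : Hypergraph V) (k : ℕ) : Prop where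
  vertexSet_eq : G.vertexSet = Set.univ
  uniform : G.IsUniform k
  connected : G.IsConnected
  acyclic : G.IsAcyclic

/-- The distance: the length of a shortest path. -/
def dist (G : Hypergraph V) (a b : V) : ℕ :=
  sInf {l | G.HasPath l a b}

/-- `r` (read `u ≺ v`) is a breadth-first-search ordering of the supertree `G` rooted at `v₀`;
the height of a vertex is its distance from `v₀`. -/
structure IsBFSOrdering (G : Hypergraph V) (v₀ : V) (r : V → V → Prop) : Prop where
  wellOrder : IsWellOrder V r
  height_le : ∀ u v, r u v → G.dist v₀ u ≤ G.dist v₀ v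
  degree_ge : ∀ u v, r u v → G.degree v ≤ G.degree u
  /-- The parents `u₁` of `u` and `v₁` of `v` are ordered (weakly) as `u` and `v` are. -/
  parent_le : ∀ e₁ ∈ G.edgeSet, ∀ e₂ ∈ G.edgeSet, ∀ u ∈ e₁, ∀ u₁ ∈ e₁, ∀ v ∈ e₂, ∀ v₁ ∈ e₂,
    r u v → G.dist v₀ u = G.dist v₀ u₁ + 1 → G.dist v₀ v = G.dist v₀ v₁ + 1 →
      u₁ = v₁ ∨ r u₁ v₁
  /-- No vertex outside an edge `e` lies between two vertices `a ≺ b` of `e`, neither of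
  which is the first vertex of `e`. -/
  consecutive : ∀ e ∈ G.edgeSet, ∀ a ∈ e, ∀ b ∈ e, (∃ c ∈ e, r c a) →
    ∀ v, v ∉ e → ¬ (r a v ∧ r v b)

/-- `G` is a `k`-uniform BFS-supertree: for some root it has a BFS-ordering. -/
def IsBFSSupertree (G : Hypergraph V) (k : ℕ) : Prop :=
  G.IsSupertree k ∧ ∃ v₀ r, G.IsBFSOrdering v₀ r

/-- Two hypergraphs are isomorphic. -/
def Isomorphic (G : Hypergraph V) (H : Hypergraph W) : Prop :=
  ∃ σ : V ≃ W, G.image σ = H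

section Finite

variable [Fintype V]

/-- The degree sequence, as a multiset. -/
def degreeSequence (G : Hypergraph V) : Multiset ℕ :=
  (Finset.univ : Finset V).val.map G.degree

/-- The number of pendent vertices, i.e. of vertices of degree one. -/
def numPendent (G : Hypergraph V) : ℕ :=
  {v | v ∈ G.vertexSet ∧ G.degree v = 1}.ncard

open Classical in
/-- The adjacency tensor of a `k`-uniform hypergraph: the entry at `(i₁, …, i_k)` is `1/(k-1)!`
if `{i₁, …, i_k}` is an edge, and `0` otherwise. -/
def adjacencyTensor (G : Hypergraph V) (k : ℕ) : CTensor k V := fun f =>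
  if Set.range f ∈ G.edgeSet then 1 / ((k - 1).factorial : ℂ) else 0

open Classical in
/-- The diagonal tensor of the degrees: the entry at `(i, i, …, i)` is the degree of `i`, and
all the other entries are `0`. -/
def degreeTensor (G : Hypergraph V) (k : ℕ) : CTensor k V := fun f =>
  ∑ i : V, if f = (fun _ => i) then (G.degree i : ℂ) else 0

/-- The signless Laplacian tensor. -/
def signlessLaplacian (G : Hypergraph V) (k : ℕ) : CTensor k V :=
  G.degreeTensor k + G.adjacencyTensor k

/-- The signless Laplacian spectral radius of a `k`-uniform hypergraph. -/
def signlessRadius (G : Hypergraph V) (k : ℕ) : ℝ :=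
  (G.signlessLaplacian k).spectralRadius

end Finite

end Hypergraph

/-- The `k`-uniform supertrees on the vertex set `Fin n` with exactly `q` pendent vertices. -/
def supertreesWithPendent (n q k : ℕ) : Set (Hypergraph (Fin n)) :=
  {G | G.IsSupertree k ∧ G.numPendent = q}

/-- The sequence `(q + 1 + (n-1)/(k-1) - n, 2, …, 2, 1, …, 1)` with `n - q - 1` twos and `q` ones. -/
def extremalDegrees (n q k : ℕ) : Multiset ℕ :=
  (q + 1 + (n - 1) / (k - 1) - n) ::ₘ
    (Multiset.replicate (n - q - 1) 2 + Multiset.replicate q 1)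

end

/-! The spectral radius of a supertree is the maximum `M` of the form `∑_e (∑_{v∈e} x_v^k + k
∏_{v∈e} x_v)` over nonnegative `x` with `∑ x_v^k = 1`. A maximizer is positive by connectedness and
satisfies the eigenvalue equations, and by the triangle inequality no eigenvalue has modulus above
`M` (`IsPerron.signlessRadius_eq`).

Root a supertree `H` with `m` edges at a vertex where its Perron vector is largest. Every edge is
then a parent together with a block of `d = k - 1` children, and the blocks partition the vertices
other than the root, so `H` is `model P` for a function `P` giving the parents
(`IsSupertree.exists_model`). In this shape the form is `∑ x_i^k - x_0^k + ∑_j x(P j)^k + k ∑_j x(P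
j) ∏_t x(slot (j, t))`. A rearrangement inequality shows that sorting the parent values and the
child values decreasingly cannot lower the last sum (`blockSum_le_sorted`). With `s = q + m - n`,
exactly `m - s` vertices are not pendent, and each of them is the root or a parent; so at least `m -
1 - s` distinct nonzero parents occur, and the `j`-th largest parent value is at most the value at
position `j - s` (truncated at `0`) of the sorted vector. These positions are the parents
`stdParent` of the extremal hypergraph, which gives the inequality (`Admissible.form_le_stdParent`).

In the case of equality, `H` can be renumbered so that it shares a sorted Perron vector with the
extremal hypergraph and has the same values at corresponding parents; ties may still make the
parents differ. Comparing the eigenvalue equations at the parent that the first wrong block should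
have produces a later block with that parent and the same edge product (`exists_exchange`). Swapping
the two blocks preserves the vector, and repetition gives an isomorphism
(`isomorphic_stdParent_of_balanced`).

The numbering of the extremal hypergraph is a BFS-ordering. Conversely, a BFS-ordering numbers the
children block by block with monotone parents, and monotone parents are determined by the degrees
(`eq_stdParent_of_monotone`). So every `G*` is isomorphic to the extremal hypergraph. -/

noncomputable section

/-! ### The form of the signless Laplacian and its eigenvalue equations -/

namespace Hypergraph

variable {V : Type*} [Fintype V]

open Classical in
/-- The edges, as finite sets. -/
def edges (G : Hypergraph V) : Finset (Finset V) :=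
  Finset.univ.filter fun s => (s : Set V) ∈ G.edgeSet

lemma mem_edges {G : Hypergraph V} {s : Finset V} : s ∈ G.edges ↔ (s : Set V) ∈ G.edgeSet := by
  simp [edges]

lemma card_of_mem_edges {G : Hypergraph V} {k : ℕ} (hG : G.IsUniform k) {s : Finset V}
    (hs : s ∈ G.edges) : s.card = k := by
  rw [← hG _ (mem_edges.1 hs), Set.ncard_coe_finset]

open Classical in
lemma degree_eq_card (G : Hypergraph V) (i : V) :
    G.degree i = (G.edges.filter (i ∈ ·)).card := by
  unfold degree
  rw [← Set.ncard_coe_finset]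
  symm
  refine Set.ncard_congr (fun s _ => (s : Set V)) ?_ ?_ ?_
  · intro s hs
    simp only [Finset.coe_filter, Set.mem_ofPred_eq, mem_edges] at hs
    exact ⟨hs.1, by simpa using hs.2⟩
  · intro s t _ _ h
    exact_mod_cast h
  · rintro e ⟨he, hi⟩
    refine ⟨e.toFinset, ?_, by simp⟩
    simp [mem_edges, he, hi]

/-- The homogeneous form `x ↦ ∑ᵢ xᵢ (𝒬 x^{k-1})ᵢ` of the signless Laplacian. -/
def form (G : Hypergraph V) (k : ℕ) (x : V → ℝ) : ℝ :=
  ∑ s ∈ G.edges, (∑ v ∈ s, x v ^ k + k * ∏ v ∈ s, x v)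

lemma form_nonneg (G : Hypergraph V) (k : ℕ) {x : V → ℝ} (hx : ∀ v, 0 ≤ x v) :
    0 ≤ G.form k x := by
  unfold form
  refine Finset.sum_nonneg fun s _ => add_nonneg (Finset.sum_nonneg fun v _ => pow_nonneg (hx v) _)
    (mul_nonneg (Nat.cast_nonneg _) (Finset.prod_nonneg fun v _ => hx v))

lemma form_smul {G : Hypergraph V} {k : ℕ} (hG : G.IsUniform k) (c : ℝ) (x : V → ℝ) :
    G.form k (fun v => c * x v) = c ^ k * G.form k x := by
  unfold form
  rw [Finset.mul_sum]
  refine Finset.sum_congr rfl fun s hs => ?_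
  simp only [mul_pow, Finset.prod_mul_distrib, Finset.prod_const, card_of_mem_edges hG hs,
    ← Finset.mul_sum]
  ring

open Classical in
-- An edge is met once from each of its `k` vertices, which is the source of the factor `k` in
-- `form`. This is how the eigenvalue equations, multiplied by the entries and summed, are compared
-- with the form.
lemma sum_sum_edges_eq_form {G : Hypergraph V} {k : ℕ} (hG : G.IsUniform k) (x : V → ℝ) :
    ∑ i, ∑ s ∈ G.edges with i ∈ s, (x i ^ k + ∏ v ∈ s, x v) = G.form k x := by
  simp only [Finset.sum_filter]
  rw [Finset.sum_comm]
  unfold form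
  refine Finset.sum_congr rfl fun s hs => ?_
  rw [← Finset.sum_filter, Finset.filter_mem_eq_inter, Finset.univ_inter, Finset.sum_add_distrib]
  simp [card_of_mem_edges hG hs]

end Hypergraph

open Classical in
lemma CTensor.applyVec_succ {V : Type*} [Fintype V] {d : ℕ} (A : CTensor (d + 1) V) (x : V → ℂ)
    (i : V) :
    A.applyVec x i = ∑ g : Fin d → V, A (Fin.cons i g : Fin (d + 1) → V) * ∏ t, x (g t) := by
  unfold CTensor.applyVec
  symm
  refine Finset.sum_bij (fun g _ => (Fin.cons i g : Fin (d + 1) → V)) ?_ ?_ ?_ ?_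
  · intro g _
    simp only [Finset.mem_filter, Finset.mem_univ, true_and]
    intro j hj
    have : j = 0 := Fin.ext hj
    subst this
    simp
  · intro g _ g' _ h
    exact (Fin.cons_injective2 h).2
  · intro f hf
    simp only [Finset.mem_filter, Finset.mem_univ, true_and] at hf
    refine ⟨Fin.tail f, Finset.mem_univ _, ?_⟩
    rw [← hf 0 rfl]
    exact Fin.cons_self_tail f
  · intro g _
    congr 1
    have : (Finset.univ.filter fun j : Fin (d + 1) => j.val ≠ 0) =
        Finset.univ.map (Fin.succEmb d) := by
      ext j
      refine Fin.cases ?_ (fun j => ?_) j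
      · simp
      · simp
    rw [this, Finset.prod_map]
    simp

namespace Hypergraph

variable {V : Type*} [Fintype V]

open Classical in
-- A tuple of length `d + 1` whose range has `d + 1` elements is injective, so `g` runs over the
-- bijections of `Fin d` with `s.erase i`. Their number `d!` cancels the normalization of the
-- adjacency tensor.
lemma sum_prod_of_range {d : ℕ} (x : V → ℂ) (i : V) (s : Finset V) (hi : i ∈ s)
    (hs : s.card = d + 1) :
    ∑ g : Fin d → V with Set.range (Fin.cons i g : Fin (d + 1) → V) = s, ∏ t, x (g t) =
      d.factorial * ∏ v ∈ s.erase i, x v := by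
  have hcard : (s.erase i).card = d := by rw [Finset.card_erase_of_mem hi, hs]; rfl
  have key : ∀ g : Fin d → V, Set.range (Fin.cons i g : Fin (d + 1) → V) = s →
      Finset.univ.image g = s.erase i ∧ Function.Injective g := by
    intro g hg
    have h1 : Finset.univ.image (Fin.cons i g : Fin (d + 1) → V) = s := by
      apply Finset.coe_injective; simpa using hg
    have h2 : Function.Injective (Fin.cons i g : Fin (d + 1) → V) := by
      rw [← Set.injOn_univ, ← Finset.coe_univ, ← Finset.card_image_iff, h1, hs]; simp
    rw [Fin.cons_injective_iff] at h2
    refine ⟨?_, h2.2⟩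
    ext v
    rw [← h1]
    simp only [Finset.mem_image, Finset.mem_univ, true_and, Finset.mem_erase, Fin.exists_fin_succ,
      Fin.cons_zero, Fin.cons_succ]
    constructor
    · rintro ⟨t, rfl⟩
      exact ⟨fun h => h2.1 ⟨t, h⟩, Or.inr ⟨t, rfl⟩⟩
    · rintro ⟨h, h' | h'⟩
      · exact absurd h'.symm h
      · exact h'
  have h1 : ∀ g ∈ Finset.univ.filter
      (fun g : Fin d → V => Set.range (Fin.cons i g : Fin (d + 1) → V) = s),
      ∏ t, x (g t) = ∏ v ∈ s.erase i, x v := by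
    intro g hg
    obtain ⟨h1, h2⟩ := key g (Finset.mem_filter.1 hg).2
    rw [← h1, Finset.prod_image (fun a _ b _ h => h2 h)]
  rw [Finset.sum_congr rfl h1, Finset.sum_const, nsmul_eq_mul]
  congr 2
  have e : {g : Fin d → V // Set.range (Fin.cons i g : Fin (d + 1) → V) = s} ≃
      (Fin d ≃ s.erase i) := by
    refine
      { toFun := fun g => Equiv.ofBijective (fun t => ⟨g.1 t, ?_⟩) ⟨?_, ?_⟩
        invFun := fun f => ⟨fun t => (f t).1, ?_⟩
        left_inv := fun g => rfl
        right_inv := fun f => by ext; rfl }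
    · rw [← (key g.1 g.2).1]; simp
    · intro a b h
      exact (key g.1 g.2).2 (Subtype.ext_iff.1 h)
    · rintro ⟨v, hv⟩
      rw [← (key g.1 g.2).1] at hv
      obtain ⟨t, _, ht⟩ := Finset.mem_image.1 hv
      exact ⟨t, Subtype.ext ht⟩
    · rw [Fin.range_cons]
      ext v
      simp only [Set.mem_insert_iff, Set.mem_range, Finset.mem_coe]
      constructor
      · rintro (rfl | ⟨t, rfl⟩)
        · exact hi
        · exact Finset.mem_of_mem_erase (f t).2
      · intro hv
        by_cases h : v = i
        · exact Or.inl h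
        · exact Or.inr ⟨f.symm ⟨v, Finset.mem_erase.2 ⟨h, hv⟩⟩, by simp⟩
  rw [← Fintype.card_subtype, Fintype.card_congr e,
    Fintype.card_equiv (Fintype.equivOfCardEq (by rw [Fintype.card_coe, hcard, Fintype.card_fin])),
    Fintype.card_fin]

open Classical in
-- Replaces the tensor by sums over edges; the spectral arguments below use the tensor only through
-- this formula.
lemma applyVec_signlessLaplacian {G : Hypergraph V} {d : ℕ}
    (hG : G.IsUniform (d + 1)) (x : V → ℂ) (i : V) :
    (G.signlessLaplacian (d + 1)).applyVec x i =
      ∑ s ∈ G.edges with i ∈ s, (x i ^ d + ∏ v ∈ s.erase i, x v) := by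
  have hdeg : ∀ g : Fin d → V, G.degreeTensor (d + 1) (Fin.cons i g : Fin (d + 1) → V) =
      if g = fun _ => i then (G.degree i : ℂ) else 0 := by
    intro g
    unfold degreeTensor
    rw [Finset.sum_eq_single i]
    · congr 1
      rw [eq_iff_iff]
      constructor
      · intro h
        funext t
        simpa using congrFun h t.succ
      · rintro rfl
        funext t
        refine Fin.cases ?_ (fun t => ?_) t <;> simp
    · intro j _ hj
      rw [if_neg]
      intro h
      exact hj (by simpa using (congrFun h 0).symm)
    · simp
  have hadj : ∀ g : Fin d → V, G.adjacencyTensor (d + 1) (Fin.cons i g : Fin (d + 1) → V) =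
      ∑ s ∈ G.edges with i ∈ s,
        if Set.range (Fin.cons i g : Fin (d + 1) → V) = s then 1 / (d.factorial : ℂ) else 0 := by
    intro g
    unfold adjacencyTensor
    rw [Nat.add_sub_cancel]
    split_ifs with h
    · rw [Finset.sum_eq_single (Finset.univ.image (Fin.cons i g : Fin (d + 1) → V))]
      · rw [if_pos (by simp)]
      · intro s _ hs
        rw [if_neg]
        intro h'
        apply hs
        apply Finset.coe_injective
        rw [← h']; simp
      · intro h'
        exfalso; apply h'
        simp only [Finset.mem_filter, mem_edges]
        refine ⟨by simpa using h, Finset.mem_image.2 ⟨0, by simp⟩⟩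
    · symm
      refine Finset.sum_eq_zero fun s hs => ?_
      rw [if_neg]
      intro h'
      apply h
      rw [h']
      exact mem_edges.1 (Finset.mem_filter.1 hs).1
  rw [CTensor.applyVec_succ]
  have : ∀ g : Fin d → V, G.signlessLaplacian (d + 1) (Fin.cons i g : Fin (d + 1) → V) *
      ∏ t, x (g t) = (if g = fun _ => i then (G.degree i : ℂ) * ∏ t, x (g t) else 0) +
      ∑ s ∈ G.edges with i ∈ s, 1 / (d.factorial : ℂ) *
        if Set.range (Fin.cons i g : Fin (d + 1) → V) = s then ∏ t, x (g t) else 0 := by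
    intro g
    unfold signlessLaplacian
    rw [Pi.add_apply, hdeg, hadj, add_mul, Finset.sum_mul]
    congr 1
    · split_ifs <;> simp
    · refine Finset.sum_congr rfl fun s _ => ?_
      split_ifs <;> simp
  simp_rw [this]
  rw [Finset.sum_add_distrib, Finset.sum_comm, Finset.sum_add_distrib]
  congr 1
  · simp [degree_eq_card]
  · refine Finset.sum_congr rfl fun s hs => ?_
    rw [Finset.mem_filter] at hs
    rw [← Finset.mul_sum, ← Finset.sum_filter,
      sum_prod_of_range x i s hs.2 (card_of_mem_edges hG hs.1), ← mul_assoc, one_div,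
      inv_mul_cancel₀ (Nat.cast_ne_zero.2 d.factorial_ne_zero), one_mul]

end Hypergraph

/-! ### Perron vectors and the variational description of the spectral radius -/

namespace Hypergraph

variable {V : Type*} [Fintype V]

/-- A connected hypergraph has an edge across every cut. -/
lemma IsConnected.exists_crossing {V : Type*} {G : Hypergraph V} (hG : G.IsConnected)
    {S : Set V} {a b : V} (ha : a ∈ G.vertexSet) (hb : b ∈ G.vertexSet) (haS : a ∈ S) (hbS : b ∉ S) :
    ∃ e ∈ G.edgeSet, ∃ u ∈ e, ∃ v ∈ e, u ∈ S ∧ v ∉ S := by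
  obtain ⟨l, v, e, ⟨⟨-, h⟩, -, -⟩, h0, hl⟩ := hG.2 a ha b hb
  by_contra! hc
  have : ∀ i : Fin (l + 1), v i ∈ S := by
    intro i
    induction i using Fin.induction with
    | zero => rwa [h0]
    | succ i ih =>
      by_contra hi
      exact hi (hc _ (h i).1 _ (h i).2.1 _ (h i).2.2 ih)
  exact hbS (hl ▸ this _)

/-- `x` maximizes the form relative to `∑ xᵢᵏ`, with value `M`. -/
structure IsPerron (G : Hypergraph V) (k : ℕ) (M : ℝ) (x : V → ℝ) : Prop where
  nonneg : ∀ v, 0 ≤ x v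
  sum_pow : ∑ v, x v ^ k = 1
  form_eq : G.form k x = M
  form_le : ∀ y : V → ℝ, (∀ v, 0 ≤ y v) → G.form k y ≤ M * ∑ v, y v ^ k

/-- The nonnegative vectors with `∑ xᵢᵏ = 1` form a compact set, which gives a maximizer;
homogeneity of degree `k` extends the bound to all nonnegative vectors. -/
lemma exists_isPerron [Nonempty V] {G : Hypergraph V} {k : ℕ} (hk : 1 ≤ k) (hG : G.IsUniform k) :
    ∃ M x, G.IsPerron k M x := by
  classical
  set K : Set (V → ℝ) := {x | (∀ v, 0 ≤ x v) ∧ ∑ v, x v ^ k = 1} with hK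
  have hk0 : k ≠ 0 := by omega
  have hclosed : IsClosed K := by
    have h1 : IsClosed {x : V → ℝ | ∀ v, 0 ≤ x v} := by
      have : {x : V → ℝ | ∀ v, 0 ≤ x v} = ⋂ v, {x | 0 ≤ x v} := by ext; simp
      rw [this]
      exact isClosed_iInter fun v => isClosed_le continuous_const (continuous_apply v)
    have h2 : IsClosed {x : V → ℝ | ∑ v, x v ^ k = 1} :=
      isClosed_eq (by fun_prop) continuous_const
    exact h1.inter h2
  have hsub : K ⊆ Set.Icc (fun _ => 0) (fun _ => 1) := by
    rintro x ⟨h0, h1⟩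
    refine ⟨h0, fun v => ?_⟩
    have : x v ^ k ≤ 1 := by
      rw [← h1]
      exact Finset.single_le_sum (f := fun v => x v ^ k) (fun v _ => pow_nonneg (h0 v) k)
        (Finset.mem_univ v)
    exact (pow_le_one_iff_of_nonneg (h0 v) hk0).1 this
  have hcomp : IsCompact K := isCompact_Icc.of_isClosed_subset hclosed hsub
  have hne : K.Nonempty := by
    obtain ⟨v⟩ := ‹Nonempty V›
    refine ⟨Pi.single v 1, fun u => ?_, ?_⟩
    · by_cases h : u = v
      · subst h; simp
      · simp [h]
    · rw [Finset.sum_eq_single v] <;> simp +contextual [hk0]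
  have hcont : Continuous (G.form k) := by
    unfold form
    fun_prop
  obtain ⟨x, hx, hmax⟩ := hcomp.exists_isMaxOn hne hcont.continuousOn
  refine ⟨G.form k x, x, hx.1, hx.2, rfl, fun y hy => ?_⟩
  set S := ∑ v, y v ^ k with hS
  have hS0 : 0 ≤ S := Finset.sum_nonneg fun v _ => pow_nonneg (hy v) k
  rcases hS0.eq_or_lt with h0 | hpos
  · have hz : ∀ v, y v = 0 := by
      intro v
      have := (Finset.sum_eq_zero_iff_of_nonneg (fun v _ => pow_nonneg (hy v) k)).1 h0.symm v
        (Finset.mem_univ v)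
      exact pow_eq_zero_iff hk0 |>.1 this
    have hy0 : y = fun v => (0 : ℝ) * x v := by funext v; simp [hz v]
    rw [hy0, form_smul hG, zero_pow hk0, ← h0]
    simp
  · set c := S ^ ((k : ℝ)⁻¹) with hc
    have hcpos : 0 < c := Real.rpow_pos_of_pos hpos _
    have hck : c ^ k = S := Real.rpow_inv_natCast_pow hS0 hk0
    have hy' : y = fun v => c * (c⁻¹ * y v) := by
      funext v; field_simp
    have hmem : (fun v => c⁻¹ * y v) ∈ K := by
      refine ⟨fun v => mul_nonneg (inv_nonneg.2 hcpos.le) (hy v), ?_⟩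
      simp only [mul_pow, ← Finset.mul_sum, inv_pow, hck]
      exact inv_mul_cancel₀ hpos.ne'
    have h1 := hmax hmem
    rw [hy', form_smul hG, hck, mul_comm]
    exact mul_le_mul_of_nonneg_right h1 hS0

/-- If some entry vanished, connectedness would give an edge with both zero and nonzero entries.
Raising its `z < k` zero entries to `ε` gains at least `k * c * ε ^ z` in the form, where `c` is the
product of its nonzero entries, whereas `form_le` allows a gain of at most `M * z * ε ^ k`. This
fails for small `ε`. -/
lemma IsPerron.pos {G : Hypergraph V} {k : ℕ} {M : ℝ} {x : V → ℝ} (h : G.IsPerron k M x)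
    (hk : 2 ≤ k) (hG : G.IsUniform k) (hc : G.IsConnected) (hV : G.vertexSet = Set.univ) (v : V) :
    0 < x v := by
  classical
  have hk0 : k ≠ 0 := by omega
  by_contra hv
  have hv0 : x v = 0 := le_antisymm (not_lt.1 hv) (h.nonneg v)
  obtain ⟨u, hu⟩ : ∃ u, x u ≠ 0 := by
    by_contra! hall
    have := h.sum_pow
    simp [hall, hk0] at this
  obtain ⟨e, he, a, hae, b, hbe, ha, hb⟩ := hc.exists_crossing (S := {v | x v = 0}) (a := v)
    (b := u) (hV ▸ Set.mem_univ _) (hV ▸ Set.mem_univ _) hv0 hu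
  set s : Finset V := e.toFinset with hs
  have hsE : s ∈ G.edges := by rw [mem_edges, hs]; simpa using he
  have hcard := card_of_mem_edges hG hsE
  set Z := s.filter (fun v => x v = 0) with hZ
  have haZ : a ∈ Z := by simp [hZ, hs, hae]; exact ha
  have hZpos : 0 < Z.card := Finset.card_pos.2 ⟨a, haZ⟩
  have hZlt : Z.card < k := by
    rw [← hcard]
    refine Finset.card_lt_card (Finset.filter_ssubset.2 ⟨b, by simpa [hs] using hbe, hb⟩)
  have hM : 0 ≤ M := h.form_eq ▸ form_nonneg G k h.nonneg
  set c := ∏ v ∈ s with x v ≠ 0, x v with hcdef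
  have hcpos : 0 < c := Finset.prod_pos fun v hv =>
    lt_of_le_of_ne (h.nonneg v) (Finset.mem_filter.1 hv).2.symm
  have key : ∀ ε : ℝ, 0 < ε → k * (ε ^ Z.card * c) ≤ M * (Z.card * ε ^ k) := by
    intro ε hε
    set y : V → ℝ := fun v => if v ∈ Z then ε else x v with hy
    have hxy : ∀ v, x v ≤ y v := by
      intro v
      simp only [hy]
      split_ifs with hvZ
      · rw [(Finset.mem_filter.1 hvZ).2]; exact hε.le
      · exact le_rfl
    have hy0 : ∀ v, 0 ≤ y v := fun v => (h.nonneg v).trans (hxy v)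
    have hsum : ∑ v, y v ^ k = 1 + Z.card * ε ^ k := by
      have : ∀ v, y v ^ k = x v ^ k + if v ∈ Z then ε ^ k else 0 := by
        intro v
        simp only [hy]
        split_ifs with hvZ
        · rw [(Finset.mem_filter.1 hvZ).2, zero_pow hk0, zero_add]
        · rw [add_zero]
      simp_rw [this]
      rw [Finset.sum_add_distrib, h.sum_pow]
      simp
    have hprodx : ∏ v ∈ s, x v = 0 :=
      Finset.prod_eq_zero (Finset.mem_filter.1 haZ).1 ha
    have hprody : ∏ v ∈ s, y v = ε ^ Z.card * c := by
      rw [← Finset.prod_filter_mul_prod_filter_not s (fun v => x v = 0)]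
      congr 1
      · rw [← hZ, Finset.prod_congr rfl (g := fun _ => ε) (by intro v hv; simp [hy, hv]),
          Finset.prod_const]
      · refine Finset.prod_congr rfl fun v hv => ?_
        have : v ∉ Z := fun h' => (Finset.mem_filter.1 hv).2 (Finset.mem_filter.1 h').2
        simp [hy, this]
    have hform : G.form k x + k * (ε ^ Z.card * c) ≤ G.form k y := by
      rw [← sub_nonneg, ← sub_sub, sub_nonneg]
      unfold form
      rw [← Finset.sum_sub_distrib]
      have h1 : ∀ t : Finset V, ∑ v ∈ t, x v ^ k ≤ ∑ v ∈ t, y v ^ k := fun t =>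
        Finset.sum_le_sum fun v _ => pow_le_pow_left₀ (h.nonneg v) (hxy v) k
      refine le_trans ?_ (Finset.single_le_sum (f := fun t =>
        (∑ v ∈ t, y v ^ k + k * ∏ v ∈ t, y v) - (∑ v ∈ t, x v ^ k + k * ∏ v ∈ t, x v)) ?_ hsE)
      · simp only [hprodx, hprody]
        linarith [h1 s]
      · intro t _
        have h2 : ∏ v ∈ t, x v ≤ ∏ v ∈ t, y v :=
          Finset.prod_le_prod (fun v _ => h.nonneg v) fun v _ => hxy v
        have h3 := mul_le_mul_of_nonneg_left h2 (Nat.cast_nonneg (α := ℝ) k)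
        linarith [h1 t]
    have := h.form_le y hy0
    rw [hsum, mul_add, mul_one] at this
    linarith [h.form_eq]
  -- Chosen such that `ε ≤ 1` and `ε * (M * Z.card + 1) < k * c`. The `+ 1` keeps the denominator
  -- positive, and the halving makes the inequality strict.
  set ε := min 1 (k * c / (M * Z.card + 1)) / 2 with hε
  have hkpos : (0 : ℝ) < k := by positivity
  have hden : 0 < M * Z.card + 1 := by positivity
  have hεpos : 0 < ε := by positivity
  have hε1 : ε ≤ 1 := by
    have : min 1 (k * c / (M * Z.card + 1)) ≤ 1 := min_le_left _ _
    rw [hε]; linarith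
  have hε2 : ε * (M * Z.card + 1) < k * c := by
    have h1 : min 1 (k * c / (M * Z.card + 1)) ≤ k * c / (M * Z.card + 1) := min_le_right _ _
    have h2 : 0 < k * c / (M * Z.card + 1) := by positivity
    rw [← lt_div_iff₀ hden, hε]
    linarith
  have h1 := key ε hεpos
  have h2 : ε ^ k ≤ ε ^ Z.card * ε := by
    rw [← pow_succ]
    exact pow_le_pow_of_le_one hεpos.le hε1 hZlt
  have h3 : M * (Z.card * ε ^ k) ≤ M * (Z.card * (ε ^ Z.card * ε)) := by gcongr
  have h4 : ε ^ Z.card * (k * c) ≤ ε ^ Z.card * (ε * (M * Z.card)) := by linarith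
  have h5 := le_of_mul_le_mul_left h4 (by positivity)
  nlinarith

open Classical in
/-- The eigenvalue equations at a positive maximizer, multiplied by the entries. -/
lemma IsPerron.eq {G : Hypergraph V} {k : ℕ} {M : ℝ} {x : V → ℝ} (h : G.IsPerron k M x)
    (hk : 1 ≤ k) (i : V) :
    ∑ s ∈ G.edges with i ∈ s, (x i ^ k + ∏ v ∈ s, x v) = M * x i ^ k := by
  have hk0 : k ≠ 0 := by omega
  set E := G.edges.filter (i ∈ ·) with hE
  -- Scaling the single entry `x i` by `t` changes only the edges through `i`. The slack in
  -- `form_le` becomes a function of `t ≥ 0` that is nonnegative and vanishes at `t = 1`, so its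
  -- derivative at `1` is zero, and this is the eigenvalue equation.
  have key : ∀ t : ℝ, 0 ≤ t →
      ∑ s ∈ E, ((t ^ k - 1) * x i ^ k + k * ((t - 1) * ∏ v ∈ s, x v)) ≤
        M * ((t ^ k - 1) * x i ^ k) := by
    intro t ht
    set y : V → ℝ := Function.update x i (t * x i) with hy
    have hyi : y i = t * x i := by simp [hy]
    have hyj : ∀ j, j ≠ i → y j = x j := fun j hj => by simp [hy, hj]
    have hy0 : ∀ v, 0 ≤ y v := by
      intro v
      by_cases hv : v = i
      · rw [hv, hyi]; exact mul_nonneg ht (h.nonneg i)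
      · rw [hyj v hv]; exact h.nonneg v
    have hsum : ∀ s : Finset V, i ∈ s → ∑ v ∈ s, y v ^ k = ∑ v ∈ s, x v ^ k + (t ^ k - 1) * x i ^ k := by
      intro s hs
      rw [← Finset.add_sum_erase s _ hs, ← Finset.add_sum_erase s (fun v => x v ^ k) hs, hyi,
        Finset.sum_congr rfl (g := fun v => x v ^ k)
          (fun v hv => by rw [hyj v (Finset.ne_of_mem_erase hv)])]
      ring
    have hprod : ∀ s : Finset V, i ∈ s → ∏ v ∈ s, y v = ∏ v ∈ s, x v + (t - 1) * ∏ v ∈ s, x v := by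
      intro s hs
      rw [← Finset.mul_prod_erase s _ hs, ← Finset.mul_prod_erase s x hs, hyi,
        Finset.prod_congr rfl (g := x) (fun v hv => hyj v (Finset.ne_of_mem_erase hv))]
      ring
    have hform : G.form k y = G.form k x +
        ∑ s ∈ E, ((t ^ k - 1) * x i ^ k + k * ((t - 1) * ∏ v ∈ s, x v)) := by
      unfold form
      rw [hE, Finset.sum_filter, ← Finset.sum_add_distrib]
      refine Finset.sum_congr rfl fun s _ => ?_
      split_ifs with hs
      · rw [hsum s hs, hprod s hs]; ring
      · have hne : ∀ v ∈ s, y v = x v := fun v hv => hyj v (by rintro rfl; exact hs hv)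
        rw [Finset.prod_congr rfl hne,
          Finset.sum_congr rfl (g := fun v => x v ^ k) (fun v hv => by rw [hne v hv]), add_zero]
    have h1 := h.form_le y hy0
    rw [hform, hsum _ (Finset.mem_univ i), h.sum_pow, h.form_eq, mul_add] at h1
    linarith
  set D := M * x i ^ k - ∑ s ∈ E, x i ^ k with hD
  set B := ∑ s ∈ E, ∏ v ∈ s, x v with hB
  have key' : ∀ t : ℝ, 0 ≤ t → 0 ≤ D * (t ^ k - 1) - k * B * (t - 1) := by
    intro t ht
    have := key t ht
    rw [Finset.sum_add_distrib, ← Finset.mul_sum, ← Finset.mul_sum, ← Finset.mul_sum] at this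
    rw [hD, hB]
    linarith
  have hmin : IsLocalMin (fun t : ℝ => D * (t ^ k - 1) - k * B * (t - 1)) 1 := by
    filter_upwards [lt_mem_nhds (show (0 : ℝ) < 1 by norm_num)] with t ht
    simpa using key' t ht.le
  have hder : HasDerivAt (fun t : ℝ => D * (t ^ k - 1) - k * B * (t - 1))
      (D * (k * 1 ^ (k - 1)) - k * B * 1) 1 :=
    (((hasDerivAt_pow k (1 : ℝ)).sub_const 1).const_mul D).sub
      (((hasDerivAt_id (1 : ℝ)).sub_const 1).const_mul (k * B))
  have h0 := hmin.hasDerivAt_eq_zero hder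
  have hkR : (k : ℝ) ≠ 0 := Nat.cast_ne_zero.2 hk0
  have h1 : (k : ℝ) * (D - B) = 0 := by rw [one_pow] at h0; linarith
  have h2 : D - B = 0 := (mul_eq_zero.1 h1).resolve_left hkR
  rw [Finset.sum_add_distrib]
  rw [hD] at h2
  linarith

/-- The moduli of an eigenvector form a test vector: the triangle inequality in the eigenvalue
equations, multiplied by the entries and summed, bounds `‖lam‖ * ∑ ‖z i‖ ^ k` by the form, hence by
`M * ∑ ‖z i‖ ^ k`. -/
lemma IsPerron.norm_le {G : Hypergraph V} {k : ℕ} {M : ℝ} {x : V → ℝ} (h : G.IsPerron k M x)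
    (hk : 1 ≤ k) (hG : G.IsUniform k) {lam : ℂ} (hlam : (G.signlessLaplacian k).IsEigenvalue lam) :
    ‖lam‖ ≤ M := by
  classical
  obtain ⟨d, rfl⟩ : ∃ d, k = d + 1 := ⟨k - 1, by omega⟩
  obtain ⟨z, hz, heq⟩ := hlam
  have h1 : ∀ i, ‖lam‖ * ‖z i‖ ^ (d + 1) ≤
      ∑ s ∈ G.edges with i ∈ s, (‖z i‖ ^ (d + 1) + ∏ v ∈ s, ‖z v‖) := by
    intro i
    have h2 := heq i
    rw [applyVec_signlessLaplacian hG, Nat.add_sub_cancel] at h2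
    have h3 : ‖lam‖ * ‖z i‖ ^ d ≤
        ∑ s ∈ G.edges with i ∈ s, (‖z i‖ ^ d + ∏ v ∈ s.erase i, ‖z v‖) := by
      rw [← norm_pow, ← norm_mul, ← h2]
      refine (norm_sum_le _ _).trans (Finset.sum_le_sum fun s _ => ?_)
      refine (norm_add_le _ _).trans ?_
      rw [norm_pow, norm_prod]
    have h4 := mul_le_mul_of_nonneg_right h3 (norm_nonneg (z i))
    rw [mul_assoc, ← pow_succ, Finset.sum_mul] at h4
    refine h4.trans (Finset.sum_le_sum fun s hs => ?_)
    rw [add_mul, ← pow_succ, mul_comm (∏ v ∈ s.erase i, ‖z v‖),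
      Finset.mul_prod_erase s (fun v => ‖z v‖) (Finset.mem_filter.1 hs).2]
  have h2 := Finset.sum_le_sum fun i (_ : i ∈ Finset.univ) => h1 i
  rw [sum_sum_edges_eq_form hG, ← Finset.mul_sum] at h2
  have h3 := h2.trans (h.form_le _ fun v => norm_nonneg (z v))
  refine le_of_mul_le_mul_right h3 ?_
  obtain ⟨i, hi⟩ := Function.ne_iff.1 hz
  exact Finset.sum_pos' (fun v _ => by positivity) ⟨i, Finset.mem_univ _, by
    have : 0 < ‖z i‖ := norm_pos_iff.2 hi
    positivity⟩

lemma IsPerron.isEigenvalue {G : Hypergraph V} {k : ℕ} {M : ℝ} {x : V → ℝ} (h : G.IsPerron k M x)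
    (hk : 1 ≤ k) (hG : G.IsUniform k) (hpos : ∀ v, 0 < x v) :
    (G.signlessLaplacian k).IsEigenvalue (M : ℂ) := by
  classical
  obtain ⟨d, rfl⟩ : ∃ d, k = d + 1 := ⟨k - 1, by omega⟩
  refine ⟨fun v => (x v : ℂ), ?_, fun i => ?_⟩
  · intro h0
    have : ∀ v, x v = 0 := fun v => by simpa using congrFun h0 v
    have h1 := h.sum_pow
    simp [this] at h1
  · rw [applyVec_signlessLaplacian hG, Nat.add_sub_cancel]
    have h1 := h.eq hk i
    have h2 : ∑ s ∈ G.edges with i ∈ s, (x i ^ d + ∏ v ∈ s.erase i, x v) = M * x i ^ d := by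
      refine mul_right_cancel₀ (hpos i).ne' ?_
      rw [mul_assoc, ← pow_succ, ← h1, Finset.sum_mul]
      refine Finset.sum_congr rfl fun s hs => ?_
      rw [add_mul, ← pow_succ, mul_comm (∏ v ∈ s.erase i, x v),
        Finset.mul_prod_erase s x (Finset.mem_filter.1 hs).2]
    rw [← Complex.ofReal_pow, ← Complex.ofReal_mul, ← h2]
    push_cast
    rfl

lemma IsPerron.signlessRadius_eq {G : Hypergraph V} {k : ℕ} {M : ℝ} {x : V → ℝ}
    (h : G.IsPerron k M x) (hk : 2 ≤ k) (hG : G.IsUniform k) (hc : G.IsConnected)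
    (hV : G.vertexSet = Set.univ) : G.signlessRadius k = M := by
  have hM : 0 ≤ M := h.form_eq ▸ form_nonneg G k h.nonneg
  refine IsGreatest.csSup_eq ⟨⟨M, h.isEigenvalue (by omega) hG (h.pos hk hG hc hV), ?_⟩, ?_⟩
  · rw [Complex.norm_real, Real.norm_of_nonneg hM]
  · rintro r ⟨lam, hlam, rfl⟩
    exact h.norm_le (by omega) hG hlam

/-- The signless Laplacian spectral radius of a supertree is attained by a positive vector. -/
lemma IsSupertree.exists_isPerron {G : Hypergraph V} {k : ℕ} (hG : G.IsSupertree k) (hk : 2 ≤ k) :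
    ∃ x, G.IsPerron k (G.signlessRadius k) x ∧ ∀ v, 0 < x v := by
  obtain ⟨a, -⟩ := hG.connected.1
  have : Nonempty V := ⟨a⟩
  obtain ⟨M, x, h⟩ := Hypergraph.exists_isPerron (by omega : 1 ≤ k) hG.uniform
  rw [h.signlessRadius_eq hk hG.uniform hG.connected hG.vertexSet_eq]
  exact ⟨x, h, h.pos hk hG.uniform hG.connected hG.vertexSet_eq⟩

end Hypergraph

/-! ### Invariance of the spectral radius under isomorphism -/

namespace Hypergraph

section Isomorphism

variable {U V W : Type*}

lemma Isomorphic.symm {G : Hypergraph V} {H : Hypergraph W} (h : G.Isomorphic H) :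
    H.Isomorphic G := by
  obtain ⟨σ, rfl⟩ := h
  exact ⟨σ.symm, by rw [image_image]; simp [Hypergraph.ext_iff]⟩

lemma Isomorphic.trans {F : Hypergraph U} {G : Hypergraph V} {H : Hypergraph W}
    (h : F.Isomorphic G) (h' : G.Isomorphic H) : F.Isomorphic H := by
  obtain ⟨σ, rfl⟩ := h
  obtain ⟨τ, rfl⟩ := h'
  exact ⟨σ.trans τ, by rw [image_image]; rfl⟩

variable [Fintype V] [Fintype W]

lemma edges_image (G : Hypergraph V) (σ : V ≃ W) :
    (G.image σ).edges = G.edges.map (Finset.mapEmbedding σ.toEmbedding).toEmbedding := by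
  ext s
  simp only [mem_edges, mem_edgeSet_image, Finset.mem_map]
  constructor
  · rintro ⟨e, he, hes⟩
    refine ⟨s.map σ.symm.toEmbedding, ?_, ?_⟩
    · rw [Finset.coe_map, ← hes]
      simpa [Set.image_image] using he
    · ext v; simp
  · rintro ⟨t, ht, rfl⟩
    exact ⟨t, ht, by simp⟩

lemma form_image (G : Hypergraph V) (σ : V ≃ W) (k : ℕ) (y : W → ℝ) :
    (G.image σ).form k y = G.form k (y ∘ σ) := by
  unfold form
  rw [edges_image, Finset.sum_map]
  simp

/-- The Perron vector of `G`, transported along the isomorphism, is a test vector for `H`. -/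
lemma Isomorphic.signlessRadius_le {G : Hypergraph V} {H : Hypergraph W} {k : ℕ}
    (h : G.Isomorphic H) (hk : 2 ≤ k) (hG : G.IsSupertree k) (hH : H.IsSupertree k) :
    G.signlessRadius k ≤ H.signlessRadius k := by
  obtain ⟨x, hx, hpos⟩ := hG.exists_isPerron hk
  obtain ⟨y, hy, -⟩ := hH.exists_isPerron hk
  obtain ⟨σ, rfl⟩ := h
  have h1 := hy.form_le (x ∘ σ.symm) (fun v => (hpos _).le)
  have h2 : ∑ v, (x ∘ σ.symm) v ^ k = 1 := by
    rw [← hx.sum_pow]; exact Equiv.sum_comp σ.symm (fun v => x v ^ k)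
  rw [form_image, h2, mul_one, Function.comp_assoc, Equiv.symm_comp_self, Function.comp_id,
    hx.form_eq] at h1
  exact h1

lemma Isomorphic.signlessRadius_eq {G : Hypergraph V} {H : Hypergraph W} {k : ℕ}
    (h : G.Isomorphic H) (hk : 2 ≤ k) (hG : G.IsSupertree k) (hH : H.IsSupertree k) :
    G.signlessRadius k = H.signlessRadius k :=
  (h.signlessRadius_le hk hG hH).antisymm (h.symm.signlessRadius_le hk hH hG)

end Isomorphism

end Hypergraph

/-! ### Numbering of the vertices by a root and equal blocks -/

section Slots

variable {m d : ℕ}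

/-- The vertex number `t` of the block number `j`; the blocks partition the non-zero vertices. -/
def slot (p : Fin m × Fin d) : Fin (m * d + 1) := (finProdFinEquiv p).succ

lemma slot_val (p : Fin m × Fin d) : (slot p).val = d * p.1 + p.2 + 1 := by
  simp [slot, finProdFinEquiv, add_comm]

lemma slot_injective : Function.Injective (slot (m := m) (d := d)) :=
  (Fin.succ_injective _).comp finProdFinEquiv.injective

lemma slot_inj {p p' : Fin m × Fin d} : slot p = slot p' ↔ p = p' := slot_injective.eq_iff

lemma slot_ne_zero (p : Fin m × Fin d) : slot p ≠ 0 := Fin.succ_ne_zero _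

lemma exists_slot_eq {i : Fin (m * d + 1)} (hi : i ≠ 0) : ∃ p, slot p = i := by
  obtain ⟨j, rfl⟩ := Fin.exists_succ_eq.2 hi
  exact ⟨finProdFinEquiv.symm j, by rw [slot, Equiv.apply_symm_apply]⟩

@[elab_as_elim]
lemma slot_cases {motive : Fin (m * d + 1) → Prop} (zero : motive 0)
    (slot : ∀ p, motive (slot p)) (i : Fin (m * d + 1)) : motive i := by
  by_cases hi : i = 0
  · exact hi ▸ zero
  · obtain ⟨p, rfl⟩ := exists_slot_eq hi
    exact slot p

lemma slot_lt_slot_of_fst {p p' : Fin m × Fin d} (h : p.1 < p'.1) : slot p < slot p' := by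
  rw [Fin.lt_def, slot_val, slot_val]
  have h1 : p.1.val + 1 ≤ p'.1.val := h
  have h2 := Nat.mul_le_mul_left d h1
  have h3 := p.2.isLt
  rw [mul_add] at h2
  omega

lemma fst_le_of_slot_le {p p' : Fin m × Fin d} (h : slot p ≤ slot p') : p.1 ≤ p'.1 := by
  by_contra hc
  exact absurd (slot_lt_slot_of_fst (not_le.1 hc)) (not_lt.2 h)

lemma slot_le_slot_iff_of_fst {j : Fin m} {t t' : Fin d} : slot (j, t) ≤ slot (j, t') ↔ t ≤ t' := by
  rw [Fin.le_def, slot_val, slot_val, Fin.le_def]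
  simp

lemma fst_lt_slot (p : Fin m × Fin d) : p.1.val < (slot p).val := by
  rw [slot_val]
  have h1 : 1 ≤ d := by have := p.2.isLt; omega
  have := Nat.mul_le_mul_right p.1.val h1
  omega

lemma sum_slot {M : Type*} [AddCommMonoid M] (f : Fin (m * d + 1) → M) :
    ∑ i, f i = f 0 + ∑ j, ∑ t, f (slot (j, t)) := by
  rw [Fin.sum_univ_succ, ← finProdFinEquiv.sum_comp, Fintype.sum_prod_type]
  rfl

/-- A permutation of the slots, extended by fixing `0`. -/
def liftPerm (E : Equiv.Perm (Fin m × Fin d)) : Equiv.Perm (Fin (m * d + 1)) :=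
  (finSuccEquiv _).trans ((Equiv.optionCongr
    ((finProdFinEquiv.symm.trans E).trans finProdFinEquiv)).trans (finSuccEquiv _).symm)

@[simp] lemma liftPerm_zero (E : Equiv.Perm (Fin m × Fin d)) : liftPerm E 0 = 0 := by
  simp only [liftPerm, Equiv.trans_apply, finSuccEquiv_zero, Equiv.optionCongr_apply,
    Option.map_none, finSuccEquiv_symm_none]

@[simp] lemma liftPerm_slot (E : Equiv.Perm (Fin m × Fin d)) (p : Fin m × Fin d) :
    liftPerm E (slot p) = slot (E p) := by
  simp only [liftPerm, slot, Equiv.trans_apply, finSuccEquiv_succ, Equiv.optionCongr_apply,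
    Option.map_some, finSuccEquiv_symm_some, Equiv.symm_apply_apply]

lemma antitone_of_slot {x : Fin (m * d + 1) → ℝ} (h0 : ∀ i, x i ≤ x 0)
    (h : Antitone fun i => x (slot (finProdFinEquiv.symm i))) : Antitone x := by
  intro a b hab
  by_cases ha : a = 0
  · rw [ha]; exact h0 b
  · have hb : b ≠ 0 := fun hb => ha (Fin.le_zero_iff.1 (hb ▸ hab))
    obtain ⟨a, rfl⟩ := Fin.exists_succ_eq.2 ha
    obtain ⟨b, rfl⟩ := Fin.exists_succ_eq.2 hb
    have := h (Fin.succ_le_succ_iff.1 hab)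
    simpa only [slot, Equiv.apply_symm_apply] using this

end Slots

/-! ### Hypergraphs given by the parents of the blocks -/

namespace Hypergraph

variable {m d : ℕ}

/-- The edge number `j` of the hypergraph with the blocks as sets of children and with
parents `P`. -/
def block (P : Fin m → Fin (m * d + 1)) (j : Fin m) : Finset (Fin (m * d + 1)) :=
  insert (P j) (Finset.univ.image fun t => slot (j, t))

/-- The hypergraph whose edges consist of a block and of the parent `P j` of the block. -/
@[simps]
def model (P : Fin m → Fin (m * d + 1)) : Hypergraph (Fin (m * d + 1)) where
  vertexSet := Set.univ
  edgeSet := Set.range fun j => (block P j : Set (Fin (m * d + 1)))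
  subset_vertexSet_of_mem_edgeSet' := fun _ _ => Set.subset_univ _

/-- The edges of `model P` are distinct, and have `d + 1` vertices. -/
structure Admissible (P : Fin m → Fin (m * d + 1)) : Prop where
  parent_ne : ∀ j t, P j ≠ slot (j, t)
  injective : Function.Injective (block P)

lemma mem_block {P : Fin m → Fin (m * d + 1)} {j : Fin m} {i : Fin (m * d + 1)} :
    i ∈ block P j ↔ i = P j ∨ ∃ t, slot (j, t) = i := by
  simp [block]

lemma edges_model (P : Fin m → Fin (m * d + 1)) :
    (model P).edges = Finset.univ.image (block P) := by
  ext s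
  simp [mem_edges]

/-- The product of the entries of `x` on the edge `j`. -/
def edgeProd (P : Fin m → Fin (m * d + 1)) (x : Fin (m * d + 1) → ℝ) (j : Fin m) : ℝ :=
  x (P j) * ∏ t, x (slot (j, t))

lemma Admissible.prod_block {P : Fin m → Fin (m * d + 1)} (hP : Admissible P)
    (x : Fin (m * d + 1) → ℝ) (j : Fin m) : ∏ v ∈ block P j, x v = edgeProd P x j := by
  rw [block, Finset.prod_insert, Finset.prod_image]
  · rfl
  · intro a _ b _ h
    simpa [slot_inj] using h
  · simp only [Finset.mem_image, Finset.mem_univ, true_and, not_exists]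
    exact fun t h => hP.parent_ne j t h.symm

lemma Admissible.sum_block {P : Fin m → Fin (m * d + 1)} (hP : Admissible P)
    (x : Fin (m * d + 1) → ℝ) (j : Fin m) :
    ∑ v ∈ block P j, x v = x (P j) + ∑ t, x (slot (j, t)) := by
  rw [block, Finset.sum_insert, Finset.sum_image]
  · intro a _ b _ h
    simpa [slot_inj] using h
  · simp only [Finset.mem_image, Finset.mem_univ, true_and, not_exists]
    exact fun t h => hP.parent_ne j t h.symm

lemma Admissible.isUniform {P : Fin m → Fin (m * d + 1)} (hP : Admissible P) :
    (model P).IsUniform (d + 1) := by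
  rintro _ ⟨j, rfl⟩
  simp only [Set.ncard_coe_finset]
  rw [block, Finset.card_insert_of_notMem, Finset.card_image_of_injective]
  · simp
  · intro a b h
    simpa [slot_inj] using h
  · simp only [Finset.mem_image, Finset.mem_univ, true_and, not_exists]
    exact fun t h => hP.parent_ne j t h.symm

/-- Every vertex but `0` is a slot exactly once, so the children contribute all `k`-th powers except
that of the root, whatever `P` is. Only the parent powers and the edge products depend on `P`. -/
lemma Admissible.form_model {P : Fin m → Fin (m * d + 1)} (hP : Admissible P)
    (x : Fin (m * d + 1) → ℝ) (k : ℕ) :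
    (model P).form k x = (∑ i, x i ^ k - x 0 ^ k) + ∑ j, x (P j) ^ k +
      k * ∑ j, edgeProd P x j := by
  unfold form
  rw [edges_model, Finset.sum_image (fun a _ b _ h => hP.injective h), Finset.sum_add_distrib,
    sum_slot, Finset.mul_sum]
  simp only [hP.prod_block, hP.sum_block (fun v => x v ^ k)]
  rw [Finset.sum_add_distrib]
  ring

open Classical in
lemma Admissible.sum_edges {P : Fin m → Fin (m * d + 1)} (hP : Admissible P)
    (x : Fin (m * d + 1) → ℝ) (k : ℕ) (i : Fin (m * d + 1)) :
    ∑ s ∈ (model P).edges with i ∈ s, (x i ^ k + ∏ v ∈ s, x v) =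
      ∑ j with P j = i, (x i ^ k + edgeProd P x j) +
        ∑ j with ∃ t, slot (j, t) = i, (x i ^ k + edgeProd P x j) := by
  rw [edges_model, Finset.sum_filter, Finset.sum_image (fun a _ b _ h => hP.injective h),
    Finset.sum_filter, Finset.sum_filter, ← Finset.sum_add_distrib]
  refine Finset.sum_congr rfl fun j _ => ?_
  rw [hP.prod_block]
  by_cases h1 : P j = i <;> by_cases h2 : ∃ t, slot (j, t) = i
  · obtain ⟨t, ht⟩ := h2
    exact absurd (h1.trans ht.symm) (hP.parent_ne j t)
  · rw [if_pos (mem_block.2 (Or.inl h1.symm)), if_pos h1, if_neg h2, add_zero]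
  · rw [if_pos (mem_block.2 (Or.inr h2)), if_neg h1, if_pos h2, zero_add]
  · rw [if_neg, if_neg h1, if_neg h2, zero_add]
    rw [mem_block]
    rintro (h | h)
    · exact h1 h.symm
    · exact h2 h

open Classical in
lemma Admissible.degree_model {P : Fin m → Fin (m * d + 1)} (hP : Admissible P)
    (i : Fin (m * d + 1)) :
    (model P).degree i = (Finset.univ.filter fun j => P j = i).card + if i = 0 then 0 else 1 := by
  -- At the constant vector `1` with exponent `1` every edge contributes `2`, so both sides count
  -- edges with weight `2`.
  have h := hP.sum_edges (fun _ => (1 : ℝ)) 1 i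
  have he : ∀ j, edgeProd P (fun _ => (1 : ℝ)) j = 1 := by intro j; simp [edgeProd]
  simp only [he, Finset.prod_const_one, Finset.sum_const, nsmul_eq_mul] at h
  have h2 : (Finset.univ.filter fun j : Fin m => ∃ t : Fin d, slot (j, t) = i).card =
      if i = 0 then 0 else 1 := by
    induction i using slot_cases with
    | zero => simp [slot_ne_zero]
    | slot p =>
      rw [if_neg (slot_ne_zero p), Finset.card_eq_one]
      refine ⟨p.1, ?_⟩
      ext j
      simp only [slot_inj, Finset.mem_filter, Finset.mem_univ, true_and, Finset.mem_singleton]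
      constructor
      · rintro ⟨t, rfl⟩; rfl
      · rintro rfl; exact ⟨p.2, rfl⟩
  rw [h2] at h
  have h3 : (((model P).edges.filter (i ∈ ·)).card : ℝ) =
      (((Finset.univ.filter fun j => P j = i).card + if i = 0 then 0 else 1 : ℕ) : ℝ) := by
    push_cast at h ⊢
    linarith
  rw [degree_eq_card]
  convert Nat.cast_injective h3

/-- The parents after renumbering the blocks by `π` and the slots of each block by `ρ`. -/
def relabel (π : Equiv.Perm (Fin m)) (ρ : Fin m → Equiv.Perm (Fin d))
    (P : Fin m → Fin (m * d + 1)) (j : Fin m) : Fin (m * d + 1) :=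
  (liftPerm (Equiv.prodShear π ρ)).symm (P (π j))

lemma block_relabel (π : Equiv.Perm (Fin m)) (ρ : Fin m → Equiv.Perm (Fin d))
    (P : Fin m → Fin (m * d + 1)) (j : Fin m) :
    block (relabel π ρ P) j =
      (block P (π j)).map (liftPerm (Equiv.prodShear π ρ)).symm.toEmbedding := by
  ext i
  rw [Finset.mem_map_equiv, Equiv.symm_symm, mem_block, mem_block]
  refine or_congr ?_ ?_
  · rw [relabel, Equiv.eq_symm_apply]
  · constructor
    · rintro ⟨t, rfl⟩
      exact ⟨ρ j t, by simp [Equiv.prodShear]⟩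
    · rintro ⟨t, ht⟩
      refine ⟨(ρ j).symm t, ?_⟩
      apply (liftPerm (Equiv.prodShear π ρ)).injective
      rw [← ht]
      simp [Equiv.prodShear]

lemma admissible_relabel {P : Fin m → Fin (m * d + 1)} (hP : Admissible P)
    (π : Equiv.Perm (Fin m)) (ρ : Fin m → Equiv.Perm (Fin d)) : Admissible (relabel π ρ P) := by
  refine ⟨fun j t h => ?_, fun i j h => ?_⟩
  · rw [relabel, Equiv.symm_apply_eq, liftPerm_slot] at h
    exact hP.parent_ne _ _ h
  · rw [block_relabel, block_relabel] at h
    exact π.injective (hP.injective (Finset.map_injective _ h))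

lemma image_relabel (π : Equiv.Perm (Fin m)) (ρ : Fin m → Equiv.Perm (Fin d))
    (P : Fin m → Fin (m * d + 1)) :
    (model P).image (liftPerm (Equiv.prodShear π ρ)).symm = model (relabel π ρ P) := by
  refine Hypergraph.ext (by simp) ?_
  simp only [image_edgeSet, model_edgeSet, ← Set.range_comp]
  rw [← π.surjective.range_comp]
  congr 1
  funext j
  simp only [Function.comp, block_relabel, Finset.coe_map]
  rfl

lemma isomorphic_relabel (π : Equiv.Perm (Fin m)) (ρ : Fin m → Equiv.Perm (Fin d))
    (P : Fin m → Fin (m * d + 1)) : (model P).Isomorphic (model (relabel π ρ P)) :=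
  ⟨_, image_relabel π ρ P⟩

end Hypergraph

/-! ### A rearrangement inequality for sums of block products -/

section Rearrangement

variable {m d : ℕ}

/-- The sum over the blocks of the parent value times the product of the slot values. -/
def blockSum (y : Fin m → ℝ) (z : Fin m × Fin d → ℝ) : ℝ := ∑ j, y j * ∏ t, z (j, t)

/-- Isolates the two blocks that an exchange changes. -/
lemma add_le_add_of_sum_le {ι : Type*} [Fintype ι] {f g : ι → ℝ} {i j : ι}
    (hij : i ≠ j) (hfg : ∀ l, l ≠ i → l ≠ j → f l = g l) (h : ∑ l, f l ≤ ∑ l, g l) :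
    f i + f j ≤ g i + g j := by
  classical
  have key : ∀ e : ι → ℝ, ∑ l, e l = e i + (e j + ∑ l ∈ (Finset.univ.erase i).erase j, e l) := by
    intro e
    rw [Finset.add_sum_erase _ e (Finset.mem_erase.2 ⟨hij.symm, Finset.mem_univ j⟩),
      Finset.add_sum_erase _ e (Finset.mem_univ i)]
  rw [key f, key g, Finset.sum_congr rfl (g := g) (fun l hl => ?_)] at h
  · linarith
  · rw [Finset.mem_erase, Finset.mem_erase] at hl
    exact hfg l hl.2.1 hl.1

/-- In an arrangement with the largest block sum, of any two blocks one dominates the other. -/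
lemma dominates_of_forall_blockSum_le {y : Fin m → ℝ} {z : Fin m × Fin d → ℝ}
    (hy : ∀ j, 0 < y j) (hz : ∀ p, 0 < z p)
    (hmax : ∀ (π : Equiv.Perm (Fin m)) (τ : Equiv.Perm (Fin m × Fin d)),
      blockSum (y ∘ π) (z ∘ τ) ≤ blockSum y z)
    {i j : Fin m} (hij : i ≠ j) (hA : y j * ∏ t, z (j, t) ≤ y i * ∏ t, z (i, t)) :
    y j ≤ y i ∧ ∀ t t', z (j, t') ≤ z (i, t) := by
  constructor
  -- Exchange the two parents. With `B` and `C` the slot products of the blocks `j` and `i`,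
  -- maximality forces `C ≤ B`, while `hA` together with `y i < y j` forces `B < C`.
  · by_contra! hlt
    have h := add_le_add_of_sum_le hij (fun l hi hj => ?_) (hmax (Equiv.swap i j) 1)
    · simp only [Function.comp, Equiv.swap_apply_left, Equiv.swap_apply_right,
        Equiv.Perm.one_apply] at h
      have hB : 0 < ∏ t, z (j, t) := Finset.prod_pos fun t _ => hz _
      have hC : 0 < ∏ t, z (i, t) := Finset.prod_pos fun t _ => hz _
      set B := ∏ t, z (j, t)
      set C := ∏ t, z (i, t)
      have h1 : B < C := by
        by_contra! hc
        have : y i * C < y j * B := mul_lt_mul hlt hc hC (hy j).le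
        linarith
      nlinarith
    · simp [Equiv.swap_apply_of_ne_of_ne hi hj]
  -- The same argument for exchanging one slot of each block, with the remaining factors of the
  -- block, parent included, as coefficients.
  · intro t t'
    by_contra! hlt
    have hne : (i, t) ≠ (j, t') := fun h => hij (congrArg Prod.fst h)
    have h := add_le_add_of_sum_le hij (fun l hi hj => ?_)
      (hmax 1 (Equiv.swap (i, t) (j, t')))
    · simp only [Function.comp, Equiv.Perm.one_apply] at h
      have e1 : ∏ u, z (Equiv.swap (i, t) (j, t') (i, u)) =
          z (j, t') * ∏ u ∈ Finset.univ.erase t, z (i, u) := by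
        rw [← Finset.mul_prod_erase _ _ (Finset.mem_univ t), Equiv.swap_apply_left]
        congr 1
        refine Finset.prod_congr rfl fun u hu => ?_
        rw [Equiv.swap_apply_of_ne_of_ne]
        · intro h'; exact (Finset.ne_of_mem_erase hu) (congrArg Prod.snd h')
        · intro h'; exact hij (congrArg Prod.fst h')
      have e2 : ∏ u, z (Equiv.swap (i, t) (j, t') (j, u)) =
          z (i, t) * ∏ u ∈ Finset.univ.erase t', z (j, u) := by
        rw [← Finset.mul_prod_erase _ _ (Finset.mem_univ t'), Equiv.swap_apply_right]
        congr 1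
        refine Finset.prod_congr rfl fun u hu => ?_
        rw [Equiv.swap_apply_of_ne_of_ne]
        · intro h'; exact hij (congrArg Prod.fst h').symm
        · intro h'; exact (Finset.ne_of_mem_erase hu) (congrArg Prod.snd h')
      have e3 : ∏ u, z (i, u) = z (i, t) * ∏ u ∈ Finset.univ.erase t, z (i, u) :=
        (Finset.mul_prod_erase _ _ (Finset.mem_univ t)).symm
      have e4 : ∏ u, z (j, u) = z (j, t') * ∏ u ∈ Finset.univ.erase t', z (j, u) :=
        (Finset.mul_prod_erase _ _ (Finset.mem_univ t')).symm
      rw [e1, e2, e3, e4] at h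
      rw [e3, e4] at hA
      have hB : 0 < y j * ∏ u ∈ Finset.univ.erase t', z (j, u) :=
        mul_pos (hy j) (Finset.prod_pos fun t _ => hz _)
      have hC : 0 < y i * ∏ u ∈ Finset.univ.erase t, z (i, u) :=
        mul_pos (hy i) (Finset.prod_pos fun t _ => hz _)
      generalize ∏ u ∈ Finset.univ.erase t', z (j, u) = B at *
      generalize ∏ u ∈ Finset.univ.erase t, z (i, u) = C at *
      have h1 : y j * B < y i * C := by
        by_contra! hc
        have : z (i, t) * (y i * C) < z (j, t') * (y j * B) := mul_lt_mul hlt hc hC (hz _).le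
        linarith
      nlinarith
    · simp only [Function.comp, Equiv.Perm.one_apply]
      congr 1
      refine Finset.prod_congr rfl fun u _ => ?_
      rw [Equiv.swap_apply_of_ne_of_ne]
      · intro h'; exact hi (congrArg Prod.fst h')
      · intro h'; exact hj (congrArg Prod.fst h')

/-- Blocks of which any two are comparable can be sorted without breaking them up. -/
lemma exists_sorted_of_dominates {y : Fin m → ℝ} {z : Fin m × Fin d → ℝ} (A : Fin m → ℝ)
    (h : ∀ i j, i ≠ j → A j ≤ A i → y j ≤ y i ∧ ∀ t t', z (j, t') ≤ z (i, t)) :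
    ∃ (π : Equiv.Perm (Fin m)) (ρ : Fin m → Equiv.Perm (Fin d)), Antitone (y ∘ π) ∧
      Antitone fun i => z (Equiv.prodShear π ρ (finProdFinEquiv.symm i)) := by
  -- The blocks are sorted by `A` and the slots of each block by value; dominance between blocks
  -- makes the concatenation sorted. The signs turn increasing sorting into decreasing sorting.
  set π := Tuple.sort fun j => -A j with hπ
  set ρ : Fin m → Equiv.Perm (Fin d) := fun j => Tuple.sort fun t => -z (π j, t) with hρ
  have hA : ∀ {i j}, i ≤ j → A (π j) ≤ A (π i) := by
    intro i j hij
    have := Tuple.monotone_sort (fun j => -A j) hij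
    simpa using this
  refine ⟨π, ρ, ?_, ?_⟩
  · intro i j hij
    rcases hij.eq_or_lt with rfl | hlt
    · exact le_rfl
    · exact (h _ _ (π.injective.ne hlt.ne) (hA hij)).1
  · intro a b hab
    obtain ⟨⟨i, t⟩, rfl⟩ := finProdFinEquiv.surjective a
    obtain ⟨⟨j, u⟩, rfl⟩ := finProdFinEquiv.surjective b
    simp only [Equiv.symm_apply_apply, Equiv.prodShear, Equiv.coe_fn_mk]
    have hs : slot (i, t) ≤ slot (j, u) := Fin.succ_le_succ_iff.2 hab
    rcases (fst_le_of_slot_le hs).eq_or_lt with h1 | hlt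
    · simp only at h1
      subst h1
      have := Tuple.monotone_sort (fun t => -z (π i, t)) (slot_le_slot_iff_of_fst.1 hs)
      simpa using this
    · exact (h _ _ (π.injective.ne hlt.ne) (hA hlt.le)).2 _ _

/-- Ties may leave the sorting permutation undetermined, but not the sorted sequence. -/
lemma comp_eq_comp_of_antitone {n : ℕ} {f : Fin n → ℝ} {σ τ : Equiv.Perm (Fin n)}
    (hσ : Antitone (f ∘ σ)) (hτ : Antitone (f ∘ τ)) : f ∘ σ = f ∘ τ := by
  have := Tuple.unique_monotone (f := fun i => -f i) (σ := σ) (τ := τ)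
    (fun _ _ h => neg_le_neg (hσ h)) (fun _ _ h => neg_le_neg (hτ h))
  funext i
  simpa using congrFun this i

lemma slots_eq_of_antitone {z : Fin m × Fin d → ℝ} {σ τ : Equiv.Perm (Fin m × Fin d)}
    (hσ : Antitone fun i => z (σ (finProdFinEquiv.symm i)))
    (hτ : Antitone fun i => z (τ (finProdFinEquiv.symm i))) : z ∘ σ = z ∘ τ := by
  have h := comp_eq_comp_of_antitone (f := fun i => z (finProdFinEquiv.symm i))
    (σ := (finProdFinEquiv.symm.trans σ).trans finProdFinEquiv)
    (τ := (finProdFinEquiv.symm.trans τ).trans finProdFinEquiv)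
    (by simpa only [Function.comp_def, Equiv.trans_apply, Equiv.symm_apply_apply] using hσ)
    (by simpa only [Function.comp_def, Equiv.trans_apply, Equiv.symm_apply_apply] using hτ)
  funext p
  simpa only [Function.comp_def, Equiv.trans_apply, Equiv.symm_apply_apply] using
    congrFun h (finProdFinEquiv p)

/-- Moving whole blocks with their parents, and permuting inside blocks, only reorders summands and
factors. -/
lemma blockSum_comp (y : Fin m → ℝ) (z : Fin m × Fin d → ℝ) (π : Equiv.Perm (Fin m))
    (ρ : Fin m → Equiv.Perm (Fin d)) :
    blockSum (y ∘ π) (z ∘ Equiv.prodShear π ρ) = blockSum y z := by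
  unfold blockSum
  rw [← Equiv.sum_comp π (fun j => y j * ∏ t, z (j, t))]
  refine Finset.sum_congr rfl fun j _ => ?_
  simp only [Function.comp, Equiv.prodShear, Equiv.coe_fn_mk]
  rw [Equiv.prod_comp (ρ j) (fun t => z (π j, t))]

/-- The rearrangement inequality for blocks, with its case of equality. -/
lemma blockSum_le_sorted {y : Fin m → ℝ} {z : Fin m × Fin d → ℝ}
    (hy : ∀ j, 0 < y j) (hz : ∀ p, 0 < z p) {π₀ : Equiv.Perm (Fin m)}
    {τ₀ : Equiv.Perm (Fin m × Fin d)} (hπ : Antitone (y ∘ π₀))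
    (hτ : Antitone fun i => z (τ₀ (finProdFinEquiv.symm i))) :
    blockSum y z ≤ blockSum (y ∘ π₀) (z ∘ τ₀) ∧
      (blockSum y z = blockSum (y ∘ π₀) (z ∘ τ₀) →
        ∃ (π : Equiv.Perm (Fin m)) (ρ : Fin m → Equiv.Perm (Fin d)), Antitone (y ∘ π) ∧
          Antitone fun i => z (Equiv.prodShear π ρ (finProdFinEquiv.symm i))) := by
  -- An arrangement with the largest block sum has pairwise comparable blocks, so it can be sorted
  -- without changing its value, and the sorted value is the maximum. In the case of equality the
  -- given arrangement is itself a maximum, and the same argument sorts it block by block.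
  obtain ⟨⟨π₁, τ₁⟩, -, hmax⟩ := Finset.exists_max_image Finset.univ
    (fun q : Equiv.Perm (Fin m) × Equiv.Perm (Fin m × Fin d) => blockSum (y ∘ q.1) (z ∘ q.2))
    ⟨1, Finset.mem_univ _⟩
  replace hmax : ∀ (π : Equiv.Perm (Fin m)) (τ : Equiv.Perm (Fin m × Fin d)),
      blockSum (y ∘ π) (z ∘ τ) ≤ blockSum (y ∘ π₁) (z ∘ τ₁) :=
    fun π τ => hmax (π, τ) (Finset.mem_univ _)
  obtain ⟨π, ρ, h1, h2⟩ := exists_sorted_of_dominates (y := y ∘ π₁) (z := z ∘ τ₁) _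
    fun i j hij hA => dominates_of_forall_blockSum_le (y := y ∘ π₁) (z := z ∘ τ₁) (fun j => hy _)
      (fun p => hz _) (fun π τ => hmax (π₁ * π) (τ₁ * τ)) hij hA
  have e1 : (y ∘ π₁) ∘ π = y ∘ π₀ :=
    comp_eq_comp_of_antitone (σ := π₁ * π) (by simpa [Function.comp_assoc] using h1) hπ
  have e2 : (z ∘ τ₁) ∘ Equiv.prodShear π ρ = z ∘ τ₀ :=
    slots_eq_of_antitone (σ := τ₁ * Equiv.prodShear π ρ) (by simpa using h2) hτ
  have e3 : blockSum (y ∘ π₁) (z ∘ τ₁) = blockSum (y ∘ π₀) (z ∘ τ₀) := by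
    rw [← e1, ← e2, blockSum_comp]
  refine ⟨e3 ▸ hmax 1 1, fun heq => exists_sorted_of_dominates _
    fun i j hij hA => dominates_of_forall_blockSum_le hy hz (fun π τ => ?_) hij hA⟩
  rw [heq, ← e3]
  exact hmax π τ

end Rearrangement

/-! ### Comparison of the form with that of the extremal hypergraph -/

namespace Hypergraph

variable {m d : ℕ}

/-- The parents in the extremal hypergraph: the blocks `0, …, s` hang from `0`, and each of the
remaining blocks hangs from the first vertex that has no block yet. -/
def stdParent (m d s : ℕ) (j : Fin m) : Fin (m * d + 1) := Fin.ofNat (m * d + 1) (j - s)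

lemma stdParent_val (hd : 1 ≤ d) (s : ℕ) (j : Fin m) : (stdParent m d s j).val = j - s := by
  simp only [stdParent, Fin.ofNat]
  apply Nat.mod_eq_of_lt
  have := Nat.mul_le_mul_left m hd
  omega

lemma blockSum_mono {y y' : Fin m → ℝ} {z : Fin m × Fin d → ℝ} (hz : ∀ p, 0 < z p)
    (h : ∀ j, y j ≤ y' j) : blockSum y z ≤ blockSum y' z :=
  Finset.sum_le_sum fun j _ =>
    mul_le_mul_of_nonneg_right (h j) (Finset.prod_nonneg fun _ _ => (hz _).le)

/-- If `Q` takes at least `m - 1 - s` non-zero values, then one of the first `j + 1` values is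
at least `j - s`. -/
lemma exists_le_of_card {s n : ℕ} (Q : Fin m → Fin (n + 1))
    (hcard : m ≤ ((Finset.univ.image Q).erase 0).card + 1 + s) (j : Fin m) :
    ∃ i ≤ j, j.val - s ≤ (Q i).val := by
  by_contra! hc
  have hj := hc j le_rfl
  -- If the first `j + 1` values were all below `j - s`, the nonzero values would come from the `m -
  -- 1 - j` later indices or lie in `[1, j - s)`. These are at most `m - 2 - s` values, one too few.
  have hsub : (Finset.univ.image Q).erase 0 ⊆
      (Finset.Ioi j).image Q ∪ (Finset.univ.filter fun a : Fin (n + 1) => a.val ∈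
        Finset.Ico 1 (j.val - s)) := by
    intro a ha
    obtain ⟨h0, ha⟩ := Finset.mem_erase.1 ha
    obtain ⟨i, -, rfl⟩ := Finset.mem_image.1 ha
    rcases le_or_gt i j with hij | hij
    · refine Finset.mem_union_right _ ?_
      have h1 := hc i hij
      have h2 : (Q i).val ≠ 0 := fun h => h0 (Fin.ext h)
      simp only [Finset.mem_filter, Finset.mem_univ, true_and, Finset.mem_Ico]
      omega
    · exact Finset.mem_union_left _ (Finset.mem_image_of_mem _ (Finset.mem_Ioi.2 hij))
  have h1 := (Finset.card_le_card hsub).trans (Finset.card_union_le _ _)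
  have h2 : ((Finset.Ioi j).image Q).card ≤ m - 1 - j := by
    refine Finset.card_image_le.trans ?_
    simp
  have h3 : (Finset.univ.filter fun a : Fin (n + 1) => a.val ∈
        Finset.Ico 1 (j.val - s)).card ≤ j.val - s - 1 := by
    rw [← Nat.card_Ico 1 (j.val - s)]
    refine Finset.card_le_card_of_injOn Fin.val ?_ Fin.val_injective.injOn
    intro a ha
    simpa using ha
  omega

/-- Every form is bounded by the form of the extremal hypergraph at the sorted vector; in the case
of equality the hypergraph can be renumbered such that the vector is sorted, and such that its
values at the parents are those of the extremal hypergraph. -/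
lemma Admissible.form_le_stdParent {P : Fin m → Fin (m * d + 1)} (hP : Admissible P) {s : ℕ}
    (hd : 1 ≤ d) (hstd : Admissible (stdParent m d s)) {x : Fin (m * d + 1) → ℝ}
    (hx : ∀ i, 0 < x i) (h0 : ∀ i, x i ≤ x 0)
    (hcard : m ≤ ((Finset.univ.image P).erase 0).card + 1 + s) {k : ℕ} (hk : 1 ≤ k) :
    ∃ e : Equiv.Perm (Fin (m * d + 1)),
      (model P).form k x ≤ (model (stdParent m d s)).form k (x ∘ e) ∧
      ((model P).form k x = (model (stdParent m d s)).form k (x ∘ e) →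
        Antitone (x ∘ e) ∧ ∃ (π : Equiv.Perm (Fin m)) (ρ : Fin m → Equiv.Perm (Fin d)),
          x ∘ liftPerm (Equiv.prodShear π ρ) = x ∘ e ∧
          ∀ j, (x ∘ e) (relabel π ρ P j) = (x ∘ e) (stdParent m d s j)) := by
  set y : Fin m → ℝ := x ∘ P with hy
  set z : Fin m × Fin d → ℝ := x ∘ slot with hz
  have hy0 : ∀ j, 0 < y j := fun j => hx _
  have hz0 : ∀ p, 0 < z p := fun p => hx _
  set π₀ := Tuple.sort fun j => -y j with hπ₀
  set τ' := Tuple.sort fun i => -z (finProdFinEquiv.symm i) with hτ'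
  set τ₀ : Equiv.Perm (Fin m × Fin d) :=
    (finProdFinEquiv.trans τ').trans finProdFinEquiv.symm with hτ₀
  have hπ : Antitone (y ∘ π₀) := fun a b hab => by
    simpa using Tuple.monotone_sort (fun j => -y j) hab
  have hτ : Antitone fun i => z (τ₀ (finProdFinEquiv.symm i)) := fun a b hab => by
    have := Tuple.monotone_sort (fun i => -z (finProdFinEquiv.symm i)) hab
    simp only [hτ₀, Equiv.trans_apply, Equiv.apply_symm_apply]
    exact neg_le_neg_iff.1 this
  obtain ⟨hle, heq⟩ := blockSum_le_sorted hy0 hz0 hπ hτ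
  set e := liftPerm τ₀ with he
  have he0 : e 0 = 0 := liftPerm_zero _
  have hanti : Antitone (x ∘ e) := by
    refine antitone_of_slot (fun i => ?_) ?_
    · simp only [Function.comp, he0]; exact h0 _
    · simpa only [hz, Function.comp, he, liftPerm_slot] using hτ
  -- Among the `j + 1` largest parent values, one sits at a position at least `j - s` of the sorted
  -- vector and so is at most the value at `j - s`; the `j`-th parent value is no larger.
  have hpar : ∀ j, (y ∘ π₀) j ≤ (x ∘ e) (stdParent m d s j) := by
    intro j
    set Q : Fin m → Fin (m * d + 1) := fun j => e.symm (P (π₀ j)) with hQ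
    have hcardQ : m ≤ ((Finset.univ.image Q).erase 0).card + 1 + s := by
      have : (Finset.univ.image Q).erase 0 =
          ((Finset.univ.image P).erase 0).map e.symm.toEmbedding := by
        ext a
        simp only [hQ, Finset.mem_erase, Finset.mem_image, Finset.mem_univ, true_and,
          Finset.mem_map_equiv, Equiv.symm_symm]
        rw [← π₀.exists_congr_right (q := fun j => P j = e a)]
        refine and_congr (not_congr ?_) (exists_congr fun j => ?_)
        · rw [← he0, e.injective.eq_iff, he0]
        · rw [Equiv.symm_apply_eq]
      rw [this, Finset.card_map]
      exact hcard
    obtain ⟨i, hij, hi⟩ := exists_le_of_card Q hcardQ j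
    calc (y ∘ π₀) j ≤ (y ∘ π₀) i := hπ hij
      _ = (x ∘ e) (Q i) := by simp [hQ, hy]
      _ ≤ (x ∘ e) (stdParent m d s j) := hanti (by rw [Fin.le_def, stdParent_val hd]; exact hi)
  have hform : (model P).form k x = (∑ i, x i ^ k - x 0 ^ k) + ∑ j, (y ∘ π₀) j ^ k +
      k * blockSum y z := by
    rw [hP.form_model]
    congr 2
    exact (Equiv.sum_comp π₀ fun j => x (P j) ^ k).symm
  have hform' : (model (stdParent m d s)).form k (x ∘ e) = (∑ i, x i ^ k - x 0 ^ k) +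
      ∑ j, (x ∘ e) (stdParent m d s j) ^ k + k * blockSum ((x ∘ e) ∘ stdParent m d s) (z ∘ τ₀) := by
    rw [hstd.form_model]
    congr 2
    · have h1 : ∑ i, (x ∘ e) i ^ k = ∑ i, x i ^ k := Equiv.sum_comp e fun i => x i ^ k
      rw [h1, Function.comp_apply, he0]
    · unfold blockSum edgeProd
      refine Finset.sum_congr rfl fun j _ => ?_
      simp [hz, he]
  have hpow : ∀ j ∈ Finset.univ, (y ∘ π₀) j ^ k ≤ (x ∘ e) (stdParent m d s j) ^ k :=
    fun j _ => pow_le_pow_left₀ (hy0 _).le (hpar j) k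
  have hsum := Finset.sum_le_sum hpow
  have hbs : blockSum (y ∘ π₀) (z ∘ τ₀) ≤ blockSum ((x ∘ e) ∘ stdParent m d s) (z ∘ τ₀) :=
    blockSum_mono (fun p => hz0 _) hpar
  have hk0 : (0 : ℝ) < k := by exact_mod_cast hk
  have hkb := mul_le_mul_of_nonneg_left (hle.trans hbs) hk0.le
  refine ⟨e, ?_, fun hE => ⟨hanti, ?_⟩⟩
  · rw [hform, hform']; linarith
  -- The gains in the parent powers and in the block sum are both nonnegative, so equality of the
  -- forms makes each of them zero.
  · rw [hform, hform'] at hE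
    have hE1 : ∑ j, (y ∘ π₀) j ^ k = ∑ j, (x ∘ e) (stdParent m d s j) ^ k := by linarith
    have hE2 : blockSum y z = blockSum (y ∘ π₀) (z ∘ τ₀) := by
      refine hle.antisymm (hbs.trans (le_of_mul_le_mul_left ?_ hk0))
      linarith
    obtain ⟨π, ρ, h1, h2⟩ := heq hE2
    have hxe : x ∘ liftPerm (Equiv.prodShear π ρ) = x ∘ e := by
      have h3 := slots_eq_of_antitone (z := z) h2 hτ
      funext i
      induction i using slot_cases with
      | zero => simp [he0]
      | slot p => simpa [he, hz] using congrFun h3 p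
    refine ⟨π, ρ, hxe, fun j => ?_⟩
    have h4 := (Finset.sum_eq_sum_iff_of_le hpow).1 hE1 j (Finset.mem_univ j)
    have h5 : (y ∘ π₀) j = (x ∘ e) (stdParent m d s j) :=
      (pow_left_inj₀ (hy0 _).le (hx _).le (by omega)).1 h4
    rw [← h5, ← hxe, ← comp_eq_comp_of_antitone h1 hπ]
    simp [relabel, hy]

end Hypergraph

/-! ### The case of equality: correcting the parents by swaps of blocks -/

namespace Hypergraph

variable {m d s : ℕ}

lemma stdParent_mono (hd : 1 ≤ d) {i j : Fin m} (h : i ≤ j) :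
    stdParent m d s i ≤ stdParent m d s j := by
  rw [Fin.le_def, stdParent_val hd, stdParent_val hd]
  have : i.val ≤ j.val := h
  omega

lemma stdParent_lt_slot (hd : 1 ≤ d) (j : Fin m) (t : Fin d) :
    stdParent m d s j < slot (j, t) := by
  rw [Fin.lt_def, stdParent_val hd]
  have := fst_lt_slot (j, t)
  simp only at this
  omega

lemma stdParent_eq_zero_iff (hd : 1 ≤ d) (j : Fin m) : stdParent m d s j = 0 ↔ j.val ≤ s := by
  rw [Fin.ext_iff, stdParent_val hd, Fin.val_zero]
  omega

lemma stdParent_inj_of_ne_zero (hd : 1 ≤ d) {i j : Fin m} (h : stdParent m d s i = stdParent m d s j)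
    (h0 : stdParent m d s j ≠ 0) : i = j := by
  rw [Ne, stdParent_eq_zero_iff hd] at h0
  rw [Fin.ext_iff, stdParent_val hd, stdParent_val hd] at h
  apply Fin.ext
  omega

/-- The last slot of a block exceeds every vertex of each earlier block, whose parent precedes its
own slots; hence the blocks are distinct. -/
lemma admissible_of_lt_slot {P : Fin m → Fin (m * d + 1)} (h : ∀ j t, P j < slot (j, t)) (hd : 1 ≤ d) :
    Admissible P := by
  refine ⟨fun j t => (h j t).ne, ?_⟩
  have key : ∀ i j, i < j → block P i ≠ block P j := by
    intro i j hij heq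
    have h1 : slot (j, ⟨d - 1, by omega⟩) ∈ block P i := by
      rw [heq, mem_block]; exact Or.inr ⟨_, rfl⟩
    rw [mem_block] at h1
    rcases h1 with h1 | ⟨t, h1⟩
    · have h2 := h i ⟨d - 1, by omega⟩
      have h3 : slot (i, ⟨d - 1, by omega⟩) < slot (j, (⟨d - 1, by omega⟩ : Fin d)) :=
        slot_lt_slot_of_fst hij
      rw [h1] at h3
      exact absurd h2 (not_lt.2 h3.le)
    · have := congrArg Prod.fst (slot_injective h1)
      exact hij.ne this
  intro i j h
  by_contra hne
  rcases lt_or_gt_of_ne hne with hlt | hlt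
  · exact key _ _ hlt h
  · exact key _ _ hlt h.symm

lemma admissible_stdParent (hd : 1 ≤ d) : Admissible (stdParent m d s) :=
  admissible_of_lt_slot (stdParent_lt_slot hd) hd

/-- If the sum of a decreasing positive function over a set `A` is the sum over an initial segment
`T` with at least as many elements, then `T \ A` and `A \ T` carry a common value. -/
lemma exists_mem_sdiff_of_sum_eq {g : Fin m → ℝ} {A T : Finset (Fin m)} {c : ℝ} (hc : 0 < c)
    (hA : ∀ f ∈ A \ T, g f ≤ c) (hT : ∀ f ∈ T \ A, c ≤ g f) (hcard : A.card ≤ T.card)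
    (hsum : ∑ f ∈ A, g f = ∑ f ∈ T, g f) {j : Fin m} (hj : j ∈ T \ A) :
    ∃ j' ∈ A \ T, g j' = g j := by
  -- After cancelling `A ∩ T`, the sum over `A \ T` is at most `c` times its size, hence at most `c`
  -- times the size of `T \ A`, hence at most the sum over `T \ A`. The two sums agree, so every
  -- value involved is `c`.
  rw [← Finset.sum_sdiff_eq_sum_sdiff_iff] at hsum
  rw [← Finset.card_sdiff_le_card_sdiff_iff] at hcard
  have h1 : ∑ f ∈ A \ T, g f ≤ ∑ f ∈ A \ T, c := Finset.sum_le_sum hA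
  have h2 : ∑ f ∈ T \ A, c ≤ ∑ f ∈ T \ A, g f := Finset.sum_le_sum hT
  have h3 : ∑ f ∈ A \ T, c ≤ ∑ f ∈ T \ A, c := by
    simp only [Finset.sum_const, nsmul_eq_mul]
    have : ((A \ T).card : ℝ) ≤ (T \ A).card := by exact_mod_cast hcard
    gcongr
  have h4 : g j = c := by
    refine ((Finset.sum_eq_sum_iff_of_le hT).1 ?_ j hj).symm
    linarith
  have h5 : ∀ f ∈ A \ T, g f = c := (Finset.sum_eq_sum_iff_of_le hA).1 (by linarith)
  have h6 : 0 < ∑ f ∈ T \ A, c := Finset.sum_pos (fun _ _ => hc) ⟨j, hj⟩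
  obtain ⟨j', hj'⟩ : (A \ T).Nonempty := by
    rw [Finset.nonempty_iff_ne_empty]
    intro h
    rw [h, Finset.sum_empty] at hsum
    linarith
  exact ⟨j', hj', by rw [h5 j' hj', h4]⟩

/-- The eigenvalue equations, for a hypergraph with parents `P` and edge products `w`. -/
def Balanced (k : ℕ) (M : ℝ) (x : Fin (m * d + 1) → ℝ) (w : Fin m → ℝ)
    (P : Fin m → Fin (m * d + 1)) : Prop :=
  ∀ i, ∑ j with P j = i, (x i ^ k + w j) + ∑ j with ∃ t, slot (j, t) = i, (x i ^ k + w j) =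
    M * x i ^ k

/-- At the first block with a wrong parent, some later block has the right one, and an edge with
the same product. -/
lemma exists_exchange (hd : 1 ≤ d) (hs : s < m) {M : ℝ} {x : Fin (m * d + 1) → ℝ}
    (hx : ∀ i, 0 < x i) (hanti : Antitone x) {P : Fin m → Fin (m * d + 1)}
    (hstd : Balanced (d + 1) M x (edgeProd (stdParent m d s) x) (stdParent m d s))
    (hP : Balanced (d + 1) M x (edgeProd (stdParent m d s) x) P) {j : Fin m}
    (hlt : ∀ i < j, P i = stdParent m d s i) (hj : P j ≠ stdParent m d s j) :
    ∃ j', j < j' ∧ P j' = stdParent m d s j ∧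
      edgeProd (stdParent m d s) x j' = edgeProd (stdParent m d s) x j := by
  set w := edgeProd (stdParent m d s) x with hw
  have hw0 : ∀ f, 0 < w f := fun f => mul_pos (hx _) (Finset.prod_pos fun t _ => hx _)
  have hwanti : Antitone w := by
    intro a b hab
    refine mul_le_mul (hanti (stdParent_mono hd hab)) (Finset.prod_le_prod (fun t _ => (hx _).le)
      fun t _ => hanti ?_) (Finset.prod_nonneg fun t _ => (hx _).le) (hx _).le
    rcases hab.eq_or_lt with rfl | h
    · exact le_rfl
    · exact (slot_lt_slot_of_fst h).le
  -- A parent precedes its children, so its value bounds every factor of the edge product. This is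
  -- used below to exclude a second block at a nonzero parent.
  have hwle : ∀ f, w f ≤ x (stdParent m d s f) ^ (d + 1) := by
    intro f
    rw [hw, edgeProd, pow_succ']
    refine mul_le_mul_of_nonneg_left ?_ (hx _).le
    calc ∏ t, x (slot (f, t)) ≤ ∏ _t : Fin d, x (stdParent m d s f) :=
          Finset.prod_le_prod (fun t _ => (hx _).le) fun t _ => hanti (stdParent_lt_slot hd f t).le
      _ = _ := by simp
  -- The terms of the block containing `i` as a child are the same for both hypergraphs and cancel,
  -- leaving the blocks hanging from `i`.
  have hbal : ∀ i, ∑ f with P f = i, (x i ^ (d + 1) + w f) =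
      ∑ f with stdParent m d s f = i, (x i ^ (d + 1) + w f) := by
    intro i
    have h1 := hP i
    have h2 := hstd i
    linarith
  have hterm : ∀ i f, 0 < x i ^ (d + 1) + w f := fun i f => add_pos (pow_pos (hx i) _) (hw0 f)
  by_cases h0 : stdParent m d s j = 0
  -- At the root: `P` uses every nonzero parent of the extremal hypergraph, so it hangs at most as
  -- many blocks from `0`. The threshold is the term of the last root block `s`, since the edge
  -- products decrease.
  · set A := Finset.univ.filter fun f => P f = 0 with hA
    set T := Finset.univ.filter fun f => stdParent m d s f = 0 with hT
    have hTmem : ∀ f, f ∈ T ↔ f.val ≤ s := fun f => by simp [hT, stdParent_eq_zero_iff hd]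
    have hjT : j ∈ T \ A := by
      rw [Finset.mem_sdiff]
      refine ⟨by simp [hT, h0], ?_⟩
      simp only [hA, Finset.mem_filter, Finset.mem_univ, true_and]
      rwa [h0] at hj
    have hcard : A.card ≤ T.card := by
      have h1 : (Finset.univ.filter fun f => ¬ stdParent m d s f = 0).card ≤
          (Finset.univ.filter fun f => ¬ P f = 0).card := by
        rw [← Finset.card_image_of_injOn (s := Finset.univ.filter fun f => ¬ stdParent m d s f = 0)
          (f := stdParent m d s)
          (fun a ha b hb h => stdParent_inj_of_ne_zero hd h (by simpa using hb))]
        refine le_trans (Finset.card_le_card ?_) (Finset.card_image_le (f := P))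
        intro i hi
        obtain ⟨f, hf, rfl⟩ := Finset.mem_image.1 hi
        have hf0 : stdParent m d s f ≠ 0 := by simpa using hf
        have h2 : 0 < ∑ f' with P f' = stdParent m d s f,
            (x (stdParent m d s f) ^ (d + 1) + w f') := by
          rw [hbal]
          exact Finset.sum_pos (fun f' _ => hterm _ f') ⟨f, by simp⟩
        obtain ⟨f', hf', -⟩ := Finset.exists_ne_zero_of_sum_ne_zero h2.ne'
        have hf'' : P f' = stdParent m d s f := by simpa using hf'
        exact Finset.mem_image.2 ⟨f', by simp [hf'', hf0], hf''⟩
      have h2 := Finset.card_filter_add_card_filter_not (s := Finset.univ) (fun f => P f = 0)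
      have h3 := Finset.card_filter_add_card_filter_not (s := Finset.univ)
        (fun f => stdParent m d s f = 0)
      rw [← hA] at h2
      rw [← hT] at h3
      omega
    have hA' : ∀ f ∈ A \ T, x 0 ^ (d + 1) + w f ≤ x 0 ^ (d + 1) + w ⟨s, hs⟩ := by
      intro f hf
      rw [Finset.mem_sdiff, hTmem, not_le] at hf
      simpa using hwanti (show (⟨s, hs⟩ : Fin m) ≤ f from Fin.le_def.2 hf.2.le)
    have hT' : ∀ f ∈ T \ A, x 0 ^ (d + 1) + w ⟨s, hs⟩ ≤ x 0 ^ (d + 1) + w f := by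
      intro f hf
      rw [Finset.mem_sdiff, hTmem] at hf
      simpa using hwanti (show f ≤ (⟨s, hs⟩ : Fin m) from Fin.le_def.2 hf.1)
    obtain ⟨j', hj', hg⟩ := exists_mem_sdiff_of_sum_eq (hterm 0 ⟨s, hs⟩) hA' hT' hcard (hbal 0) hjT
    rw [Finset.mem_sdiff, hTmem, not_le] at hj'
    have hjs := (hTmem j).1 (Finset.mem_sdiff.1 hjT).1
    refine ⟨j', Fin.lt_def.2 (by omega), ?_, by simpa using hg⟩
    rw [h0]
    simpa [hA] using hj'.1
  -- At a nonzero parent the extremal side consists of the block `j` alone. Two blocks of `P` would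
  -- contribute more than `2 * x b ^ (d + 1)`, hence more than `x b ^ (d + 1) + w j`; so there is
  -- exactly one, with product `w j`.
  · set b := stdParent m d s j with hb
    have hsum := hbal b
    have hsing : (Finset.univ.filter fun f => stdParent m d s f = b) = {j} := by
      ext f
      simp only [Finset.mem_filter, Finset.mem_univ, true_and, Finset.mem_singleton]
      exact ⟨fun h => stdParent_inj_of_ne_zero hd h h0, fun h => h ▸ rfl⟩
    rw [hsing, Finset.sum_singleton] at hsum
    obtain ⟨j', hj', -⟩ := Finset.exists_ne_zero_of_sum_ne_zero (hsum.trans_ne (hterm b j).ne')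
    have hPj' : P j' = b := by simpa using hj'
    refine ⟨j', ?_, hPj', ?_⟩
    · by_contra hc
      rcases (not_lt.1 hc).eq_or_lt with rfl | h
      · exact hj hPj'
      · have := stdParent_inj_of_ne_zero hd ((hlt j' h).symm.trans hPj') h0
        exact h.ne this
    · rw [← Finset.add_sum_erase _ _ hj'] at hsum
      rcases ((Finset.univ.filter fun f => P f = b).erase j').eq_empty_or_nonempty with he | ⟨f, hf⟩
      · rw [he, Finset.sum_empty] at hsum
        linarith
      · have h1 := Finset.single_le_sum (f := fun f => x b ^ (d + 1) + w f)
          (fun f _ => (hterm b f).le) hf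
        have h2 := hwle j
        have h3 := hw0 f
        have h4 := hw0 j'
        rw [← hb] at h2
        linarith

/-- Balanced parents with the right vector values define the extremal hypergraph. -/
lemma isomorphic_stdParent_of_balanced (hd : 1 ≤ d) (hs : s < m) {M : ℝ}
    {x : Fin (m * d + 1) → ℝ} (hx : ∀ i, 0 < x i) (hanti : Antitone x)
    (hstd : Balanced (d + 1) M x (edgeProd (stdParent m d s) x) (stdParent m d s))
    (c : ℕ) (P : Fin m → Fin (m * d + 1))
    (hP : Balanced (d + 1) M x (edgeProd (stdParent m d s) x) P)
    (hxP : ∀ j, x (P j) = x (stdParent m d s j))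
    (hlt : ∀ i : Fin m, i.val + c < m → P i = stdParent m d s i) :
    (model P).Isomorphic (model (stdParent m d s)) := by
  -- `c` bounds the number of final blocks whose parents may still be wrong; each step swaps a right
  -- block into the first possibly wrong place.
  induction c generalizing P with
  | zero =>
    have : P = stdParent m d s := funext fun i => hlt i i.isLt
    rw [this]
    exact ⟨Equiv.refl _, by simp [Hypergraph.ext_iff]⟩
  | succ c ih =>
    by_cases hc : c < m
    swap
    · exact ih P hP hxP fun i hi => by omega
    set j : Fin m := ⟨m - (c + 1), by omega⟩ with hjdef
    have hltj : ∀ i < j, P i = stdParent m d s i := fun i hi => hlt i (by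
      have : i.val < m - (c + 1) := hi
      omega)
    by_cases hj : P j = stdParent m d s j
    · refine ih P hP hxP fun i hi => ?_
      rcases lt_trichotomy i j with h | h | h
      · exact hltj i h
      · exact h ▸ hj
      · have : m - (c + 1) < i.val := h
        omega
    obtain ⟨j', hjj', hPj', hw⟩ := exists_exchange hd hs hx hanti hstd hP hltj hj
    set w := edgeProd (stdParent m d s) x with hwdef
    set κ := Equiv.swap j j' with hκ
    -- The swap of the blocks `j` and `j'` preserves `x`: the parent values and the edge products
    -- agree, hence so do the slot products, and slotwise the values of `j'` are at most those of
    -- `j`.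
    set τ := liftPerm (Equiv.prodShear κ fun _ => (1 : Equiv.Perm (Fin d))) with hτ
    have hτslot : ∀ l t, τ (slot (l, t)) = slot (κ l, t) := fun l t => by
      simp [hτ, Equiv.prodShear]
    have hττ : ∀ i, τ (τ i) = i := by
      intro i
      induction i using slot_cases with
      | zero => simp [hτ]
      | slot p => rw [← Prod.mk.eta (p := p), hτslot, hτslot, hκ, Equiv.swap_apply_self]
    have hτsymm : ∀ i, τ.symm i = τ i := fun i => by rw [Equiv.symm_apply_eq, hττ]
    have hxstd : x (stdParent m d s j) = x (stdParent m d s j') := by rw [← hPj', hxP]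
    have hslots : ∀ t, x (slot (j, t)) = x (slot (j', t)) := by
      have h1 : ∏ t, x (slot (j', t)) = ∏ t, x (slot (j, t)) := by
        rw [hwdef, edgeProd, edgeProd, ← hxstd] at hw
        exact mul_left_cancel₀ (hx _).ne' hw
      by_contra! hne
      obtain ⟨t, ht⟩ := hne
      have hle : ∀ t, x (slot (j', t)) ≤ x (slot (j, t)) := fun t =>
        hanti (slot_lt_slot_of_fst hjj').le
      refine absurd h1 (Finset.prod_lt_prod (fun t _ => hx _) (fun t _ => hle t)
        ⟨t, Finset.mem_univ t, lt_of_le_of_ne (hle t) ht.symm⟩).ne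
    have hκcases : ∀ (Q : Fin m → Fin m → Prop), Q j j' → Q j' j →
        (∀ l, Q l l) → ∀ l, Q l (κ l) := by
      intro Q h1 h2 h3 l
      rcases eq_or_ne l j with rfl | hl
      · rwa [hκ, Equiv.swap_apply_left]
      rcases eq_or_ne l j' with rfl | hl'
      · rwa [hκ, Equiv.swap_apply_right]
      rw [hκ, Equiv.swap_apply_of_ne_of_ne hl hl']
      exact h3 l
    have hxτ : ∀ i, x (τ i) = x i := by
      intro i
      induction i using slot_cases with
      | zero => simp [hτ]
      | slot p =>
        obtain ⟨l, t⟩ := p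
        rw [hτslot]
        exact hκcases (fun l l' => x (slot (l', t)) = x (slot (l, t))) (hslots t).symm (hslots t)
          (fun _ => rfl) l
    have hwκ : ∀ l, w (κ l) = w l :=
      hκcases (fun l l' => w l' = w l) hw hw.symm (fun _ => rfl)
    have hsκ : ∀ l, x (stdParent m d s (κ l)) = x (stdParent m d s l) :=
      hκcases (fun l l' => x (stdParent m d s l') = x (stdParent m d s l)) hxstd.symm hxstd
        (fun _ => rfl)
    -- A slot numbered at most `j` lies in a block before `j`. So the swap moves neither the parents
    -- already settled nor the one just put in place.
    have hfix : ∀ i : Fin (m * d + 1), i.val ≤ j.val → τ i = i := by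
      intro i
      induction i using slot_cases with
      | zero => intro _; simp [hτ]
      | slot p =>
        obtain ⟨l, t⟩ := p
        intro h
        have h1 := fst_lt_slot (l, t)
        have h2 : l < j := Fin.lt_def.2 (by simp only at h1; omega)
        rw [hτslot, hκ, Equiv.swap_apply_of_ne_of_ne h2.ne (h2.trans hjj').ne]
    have hrel : ∀ l, relabel κ (fun _ => 1) P l = τ (P (κ l)) := fun l => hτsymm _
    refine (isomorphic_relabel κ (fun _ => 1) P).trans (ih _ ?_ ?_ ?_)
    · intro i
      rw [← hxτ i, ← hP (τ i)]
      congr 1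
      · rw [Finset.sum_filter, Finset.sum_filter, ← Equiv.sum_comp κ]
        refine Finset.sum_congr rfl fun l _ => ?_
        rw [hrel, hwκ]
        congr 1
        rw [eq_iff_iff, hκ, Equiv.swap_apply_self]
        constructor
        · intro h; rw [← h, hττ]
        · intro h; rw [h, hττ]
      · rw [Finset.sum_filter, Finset.sum_filter, ← Equiv.sum_comp κ]
        refine Finset.sum_congr rfl fun l _ => ?_
        rw [hwκ]
        congr 1
        rw [eq_iff_iff]
        constructor
        · rintro ⟨t, ht⟩
          refine ⟨t, ?_⟩
          rw [← ht, hτslot, hκ, Equiv.swap_apply_self]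
        · rintro ⟨t, ht⟩
          refine ⟨t, ?_⟩
          rw [← hτslot, ht, hττ]
    · intro l
      rw [hrel, hxτ, hxP, hsκ]
    · intro i hi
      rw [hrel]
      have hij : i.val ≤ j.val := by
        change i.val ≤ m - (c + 1)
        omega
      have hval : (stdParent m d s i).val ≤ j.val := by rw [stdParent_val hd]; omega
      rcases eq_or_ne i j with rfl | hne
      · rw [hκ, Equiv.swap_apply_left, hPj', hfix _ hval]
      · have hlt' : i < j := lt_of_le_of_ne hij hne
        rw [hκ, Equiv.swap_apply_of_ne_of_ne hne (hlt'.trans hjj').ne, hltj i hlt', hfix _ hval]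

end Hypergraph

/-! ### Distances in a supertree through its incidence tree -/

/-- In a tree every vertex but the root has exactly one neighbour that is closer to the root. -/
lemma SimpleGraph.IsTree.existsUnique_closer {U : Type*} {T : SimpleGraph U} (hT : T.IsTree)
    {r w : U} (hw : w ≠ r) : ∃! u, T.Adj w u ∧ T.dist r u + 1 = T.dist r w := by
  obtain ⟨p, -, hlen⟩ := hT.connected.exists_path_of_dist r w
  have hnil : ¬ p.Nil := fun h => hw h.eq.symm
  refine ⟨p.penultimate, ⟨(p.adj_penultimate hnil).symm, ?_⟩, ?_⟩
  · have h1 := SimpleGraph.dist_le p.dropLast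
    have h2 := hT.dist_eq_dist_add_one_of_adj r (p.adj_penultimate hnil)
    simp only [SimpleGraph.Walk.length_dropLast] at h1
    omega
  · have key : ∀ u, T.Adj w u → T.dist r u + 1 = T.dist r w →
        ∃ q : T.Walk r w, q.IsPath ∧ q.penultimate = u := by
      intro u hadj hu
      obtain ⟨q, -, hq⟩ := hT.connected.exists_path_of_dist r u
      exact ⟨q.concat hadj.symm, SimpleGraph.Walk.isPath_of_length_eq_dist _ (by simp [hq, hu]),
        by simp⟩
    rintro u ⟨hadj, hu⟩
    obtain ⟨q, hq, rfl⟩ := key u hadj hu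
    have hp := SimpleGraph.Walk.isPath_of_length_eq_dist p hlen
    rw [Subtype.mk.inj ((hT.isAcyclic.subsingleton_path r w).elim ⟨q, hq⟩ ⟨p, hp⟩)]

namespace Hypergraph

variable {V : Type*}

/-- The incidence graph between vertices and edges. -/
def incidence (G : Hypergraph V) : SimpleGraph (V ⊕ G.edgeSet) where
  Adj a b := match a, b with
    | .inl v, .inr e => v ∈ e.1
    | .inr e, .inl v => v ∈ e.1
    | _, _ => False
  symm := ⟨by rintro (v | e) (w | f) h <;> exact h⟩
  loopless := ⟨by rintro (v | e) h <;> exact h⟩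

lemma exists_eq_inr_of_adj {G : Hypergraph V} {v : V} {a : V ⊕ G.edgeSet}
    (h : G.incidence.Adj (.inl v) a) : ∃ e : G.edgeSet, a = .inr e ∧ v ∈ e.1 := by
  rcases a with w | e
  · exact h.elim
  · exact ⟨e, rfl, h⟩

lemma exists_eq_inl_of_adj {G : Hypergraph V} {e : G.edgeSet} {a : V ⊕ G.edgeSet}
    (h : G.incidence.Adj (.inr e) a) : ∃ v, a = .inl v ∧ v ∈ e.1 := by
  rcases a with w | f
  · exact ⟨w, rfl, h⟩
  · exact h.elim

lemma getVert_incidence {G : Hypergraph V} {a : V} {b : V ⊕ G.edgeSet}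
    (c : G.incidence.Walk (.inl a) b) (i : ℕ) :
    (2 * i ≤ c.length → ∃ v, c.getVert (2 * i) = .inl v) ∧
      (2 * i + 1 ≤ c.length → ∃ e, c.getVert (2 * i + 1) = .inr e) := by
  have step : ∀ i, (∃ v, c.getVert (2 * i) = .inl v) → 2 * i + 1 ≤ c.length →
      ∃ e, c.getVert (2 * i + 1) = .inr e := by
    rintro i ⟨v, hv⟩ h
    have := c.adj_getVert_succ (i := 2 * i) (by omega)
    rw [hv] at this
    obtain ⟨e, he, -⟩ := exists_eq_inr_of_adj this
    exact ⟨e, he⟩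
  induction i with
  | zero => exact ⟨fun _ => ⟨a, by simp⟩, step 0 ⟨a, by simp⟩⟩
  | succ i ih =>
    have h1 : 2 * (i + 1) ≤ c.length → ∃ v, c.getVert (2 * (i + 1)) = .inl v := by
      intro h
      obtain ⟨e, he⟩ := ih.2 (by omega)
      have := c.adj_getVert_succ (i := 2 * i + 1) (by omega)
      rw [he] at this
      obtain ⟨v, hv, -⟩ := exists_eq_inl_of_adj this
      exact ⟨v, hv⟩
    exact ⟨h1, fun h => step _ (h1 (by omega)) h⟩

/-- The even positions of the walk are vertices and the odd ones are edges, so a cycle of the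
incidence graph reads off as a cycle of the hypergraph. Its length is even and at least `3`, which
gives at least two edges. -/
lemma not_isCycle_incidence {G : Hypergraph V} (hV : G.vertexSet = Set.univ) (hG : G.IsAcyclic)
    {a : V} (c : G.incidence.Walk (.inl a) (.inl a)) : ¬ c.IsCycle := by
  intro hc
  have h3 := hc.three_le_length
  obtain ⟨l, hl⟩ : ∃ l, c.length = 2 * l := by
    rcases Nat.even_or_odd' c.length with ⟨l, h | h⟩
    · exact ⟨l, h⟩
    · obtain ⟨e, he⟩ := (getVert_incidence c l).2 h.ge
      rw [← h, c.getVert_length] at he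
      cases he
  have hv : ∀ i : Fin (l + 1), ∃ v, c.getVert (2 * i) = .inl v := fun i =>
    (getVert_incidence c i).1 (by omega)
  have he : ∀ i : Fin l, ∃ e, c.getVert (2 * i + 1) = .inr e := fun i =>
    (getVert_incidence c i).2 (by omega)
  choose v hv using hv
  choose e he using he
  refine hG l v (fun i => (e i).1) ⟨by omega, ⟨fun i => hV ▸ Set.mem_univ _, fun i => ?_⟩, ?_, ?_, ?_⟩
  · refine ⟨(e i).2, ?_, ?_⟩
    · have := c.adj_getVert_succ (i := 2 * i) (by omega)
      rw [he i, show 2 * i.val = 2 * i.castSucc.val from rfl, hv i.castSucc] at this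
      exact this
    · have := c.adj_getVert_succ (i := 2 * i + 1) (by omega)
      rw [he i, show 2 * i.val + 1 + 1 = 2 * i.succ.val from by simp; ring, hv i.succ] at this
      exact this
  · have h0 := hv 0
    have h1 := hv (Fin.last l)
    rw [Fin.val_last, ← hl, c.getVert_length] at h1
    rw [Fin.val_zero, mul_zero, c.getVert_zero] at h0
    exact Sum.inl_injective (h0.symm.trans h1)
  · intro i j hij
    have h1 : c.getVert (2 * i) = c.getVert (2 * j) := by
      have h1 := hv i.castSucc
      have h2 := hv j.castSucc
      simp only at hij
      rw [hij, ← h2] at h1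
      exact h1
    have := hc.getVert_injOn' (show 2 * i.val ≤ c.length - 1 by omega)
      (show 2 * j.val ≤ c.length - 1 by omega) h1
    apply Fin.ext
    omega
  · intro i j hij
    have h1 : c.getVert (2 * i + 1) = c.getVert (2 * j + 1) := by
      rw [he i, he j, Subtype.ext hij]
    have := hc.getVert_injOn' (show 2 * i.val + 1 ≤ c.length - 1 by omega)
      (show 2 * j.val + 1 ≤ c.length - 1 by omega) h1
    apply Fin.ext
    omega

lemma incidence_isAcyclic {G : Hypergraph V} (hV : G.vertexSet = Set.univ) (hG : G.IsAcyclic) :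
    G.incidence.IsAcyclic := by
  rintro (a | e) c hc
  · exact not_isCycle_incidence hV hG c hc
  · have hadj := c.adj_snd hc.not_nil
    obtain ⟨v, hv, -⟩ := exists_eq_inl_of_adj hadj
    have hmem : .inl v ∈ c.support := hv ▸ c.getVert_mem_support 1
    classical
    exact not_isCycle_incidence hV hG _ (hc.rotate hmem)

lemma incidence_connected {G : Hypergraph V} (hV : G.vertexSet = Set.univ) (hG : G.IsConnected)
    (hne : ∀ e ∈ G.edgeSet, e.Nonempty) : G.incidence.Connected := by
  obtain ⟨r, hr⟩ := hG.1
  have h1 : ∀ v, G.incidence.Reachable (.inl r) (.inl v) := by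
    intro v
    obtain ⟨l, p, e, ⟨⟨-, h⟩, -, -⟩, h0, hl⟩ := hG.2 r hr v (hV ▸ Set.mem_univ _)
    have : ∀ i : Fin (l + 1), G.incidence.Reachable (.inl r) (.inl (p i)) := by
      intro i
      induction i using Fin.induction with
      | zero => rw [h0]
      | succ i ih =>
        have ha : G.incidence.Adj (.inl (p i.castSucc)) (.inr ⟨e i, (h i).1⟩) := (h i).2.1
        have hb : G.incidence.Adj (.inr ⟨e i, (h i).1⟩) (.inl (p i.succ)) := (h i).2.2
        exact (ih.trans ha.reachable).trans hb.reachable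
    exact hl ▸ this (Fin.last l)
  have h2 : ∀ a, G.incidence.Reachable (.inl r) a := by
    rintro (v | e)
    · exact h1 v
    · obtain ⟨v, hv⟩ := hne e.1 e.2
      have ha : G.incidence.Adj (.inl v) (.inr e) := hv
      exact (h1 v).trans ha.reachable
  have : Nonempty (V ⊕ G.edgeSet) := ⟨.inl r⟩
  exact ⟨fun a b => (h2 a).symm.trans (h2 b)⟩

lemma IsSupertree.incidence_isTree {G : Hypergraph V} {k : ℕ} (hG : G.IsSupertree k)
    (hk : 1 ≤ k) : G.incidence.IsTree := by
  refine ⟨incidence_connected hG.vertexSet_eq hG.connected fun e he => ?_,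
    incidence_isAcyclic hG.vertexSet_eq hG.acyclic⟩
  rw [Set.nonempty_iff_ne_empty]
  rintro rfl
  have := hG.uniform _ he
  rw [Set.ncard_empty] at this
  omega

/-- A function that is `1`-Lipschitz along the edges, and decreases to `h r = 0`, is the
distance from `r`. -/
lemma hasPath_and_dist_eq_of_height {G : Hypergraph V} (hV : G.vertexSet = Set.univ) {r : V}
    {h : V → ℕ} (h0 : h r = 0) (hlip : ∀ e ∈ G.edgeSet, ∀ u ∈ e, ∀ v ∈ e, h v ≤ h u + 1)
    (hpar : ∀ v, v ≠ r → ∃ e ∈ G.edgeSet, v ∈ e ∧ ∃ u ∈ e, h u + 1 = h v) (v : V) :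
    G.HasPath (h v) r v ∧ G.dist r v = h v := by
  -- Descend from `v` to the root. The heights `0, …, l` along the walk make its vertices distinct,
  -- and the Lipschitz condition then makes its edges distinct.
  have hwalk : ∀ l v, h v = l → ∃ (p : ℕ → V) (e : ℕ → Set V), p 0 = r ∧ p l = v ∧
      (∀ i ≤ l, h (p i) = i) ∧ ∀ i < l, e i ∈ G.edgeSet ∧ p i ∈ e i ∧ p (i + 1) ∈ e i := by
    intro l
    induction l with
    | zero =>
      intro v hv
      by_cases hvr : v = r
      · exact ⟨fun _ => r, fun _ => ∅, rfl, hvr.symm, fun i hi => by simp [h0]; omega,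
          fun i hi => by omega⟩
      · obtain ⟨e, -, -, u, -, hu⟩ := hpar v hvr
        omega
    | succ l ih =>
      intro v hv
      obtain ⟨f, hf, hvf, u, huf, hu⟩ := hpar v (by rintro rfl; omega)
      obtain ⟨p, e, hp0, hpl, hph, hpe⟩ := ih u (by omega)
      refine ⟨fun i => if i ≤ l then p i else v, fun i => if i < l then e i else f,
        by simp [hp0], by simp, fun i hi => ?_, fun i hi => ?_⟩
      · simp only
        split_ifs with hil
        · exact hph i hil
        · rw [hv]; omega
      · by_cases hil : i < l
        · simpa [hil, hil.le, Nat.succ_le_of_lt hil] using hpe i hil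
        · have : i = l := by omega
          subst this
          simpa [hpl] using ⟨hf, huf, hvf⟩
  have hpath : G.HasPath (h v) r v := by
    obtain ⟨p, e, hp0, hpl, hph, hpe⟩ := hwalk _ v rfl
    refine ⟨fun i => p i, fun i => e i, ⟨⟨fun i => hV ▸ Set.mem_univ _, fun i => hpe i i.isLt⟩,
      fun i j hij => ?_, fun i j hij => ?_⟩, hp0, hpl⟩
    · have h1 := hph i (by omega)
      have h2 := hph j (by omega)
      simp only at hij
      rw [hij, h2] at h1
      exact Fin.ext h1.symm
    · have key : ∀ i j : Fin (h v), i < j → e i ≠ e j := by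
        intro i j hlt heq
        have h1 := hlip _ (hpe i i.isLt).1 _ (hpe i i.isLt).2.1 (p (j + 1))
          (by rw [heq]; exact (hpe j j.isLt).2.2)
        rw [hph _ (by omega), hph _ (by omega)] at h1
        have : i.val < j.val := hlt
        omega
      by_contra hne
      rcases lt_or_gt_of_ne hne with hlt | hlt
      · exact key _ _ hlt hij
      · exact key _ _ hlt hij.symm
  refine ⟨hpath, le_antisymm (Nat.sInf_le hpath) (le_csInf ⟨_, hpath⟩ ?_)⟩
  rintro l ⟨p, e, ⟨⟨-, hpe⟩, -, -⟩, hp0, hpl⟩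
  have : ∀ i : Fin (l + 1), h (p i) ≤ i := by
    intro i
    induction i using Fin.induction with
    | zero => simp [hp0, h0]
    | succ i ih =>
      have := hlip _ (hpe i).1 _ (hpe i).2.1 _ (hpe i).2.2
      simp only [Fin.val_castSucc, Fin.val_succ] at ih ⊢
      omega
  simpa [hpl] using this (Fin.last l)

/-- The distances from the root of a supertree: every edge has one vertex that is closer than the
others, and every vertex but the root lies in exactly one edge with a closer vertex. -/
lemma IsSupertree.dist_structure {G : Hypergraph V} {k : ℕ} (hG : G.IsSupertree k)
    (hk : 1 ≤ k) (r : V) :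
    (∀ e ∈ G.edgeSet, ∃ u ∈ e, ∀ v ∈ e, v ≠ u → G.dist r v = G.dist r u + 1) ∧
      G.dist r r = 0 ∧
      ∀ v, v ≠ r → ∃! e, e ∈ G.edgeSet ∧ v ∈ e ∧ ∃ u ∈ e, G.dist r u + 1 = G.dist r v := by
  have hT := hG.incidence_isTree hk
  set D := G.incidence.dist (.inl r) with hD
  -- A step in the hypergraph is two steps in the incidence tree. On an edge, `D` is larger by `2`
  -- at the other vertices than at the closest one, so `h` rises by exactly `1`, whatever the parity
  -- of `D`.
  set h : V → ℕ := fun v => D (.inl v) / 2 with hh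
  have hr0 : D (.inl r) = 0 := SimpleGraph.dist_self
  have hedge : ∀ e : G.edgeSet, ∃ u ∈ e.1, D (.inl u) + 1 = D (.inr e) ∧
      ∀ v ∈ e.1, v ≠ u → D (.inl v) = D (.inr e) + 1 := by
    intro e
    obtain ⟨a, ⟨ha, hda⟩, huniq⟩ := hT.existsUnique_closer (r := .inl r) (w := .inr e) (by simp)
    obtain ⟨u, rfl, hu⟩ := exists_eq_inl_of_adj ha
    refine ⟨u, hu, hda, fun v hv hvu => ?_⟩
    have hadj : G.incidence.Adj (.inr e) (.inl v) := hv
    rcases hT.dist_eq_dist_add_one_of_adj (.inl r) hadj with h1 | h1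
    · exact absurd (Sum.inl_injective (huniq _ ⟨hadj, h1.symm⟩)) hvu
    · exact h1
  have hvert : ∀ v, v ≠ r → ∃ e : G.edgeSet, v ∈ e.1 ∧ D (.inr e) + 1 = D (.inl v) ∧
      ∀ f : G.edgeSet, v ∈ f.1 → D (.inr f) + 1 = D (.inl v) → f = e := by
    intro v hv
    obtain ⟨a, ⟨ha, hda⟩, huniq⟩ := hT.existsUnique_closer (r := .inl r) (w := .inl v)
      (by simpa using hv)
    obtain ⟨e, rfl, he⟩ := exists_eq_inr_of_adj ha
    exact ⟨e, he, hda, fun f hf hdf => Sum.inr_injective (huniq (.inr f) ⟨hf, hdf⟩)⟩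
  have hlip : ∀ e ∈ G.edgeSet, ∀ u ∈ e, ∀ v ∈ e, h v ≤ h u + 1 := by
    intro e he u hu v hv
    obtain ⟨w, hw, hdw, hother⟩ := hedge ⟨e, he⟩
    have key : ∀ v ∈ e, D (.inl w) ≤ D (.inl v) ∧ D (.inl v) ≤ D (.inl w) + 2 := by
      intro v hv
      by_cases hvw : v = w
      · subst hvw; omega
      · have := hother v hv hvw; omega
    have h1 := key u hu
    have h2 := key v hv
    simp only [hh]
    omega
  have hpar : ∀ v, v ≠ r → ∃ e ∈ G.edgeSet, v ∈ e ∧ ∃ u ∈ e, h u + 1 = h v := by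
    intro v hv
    obtain ⟨e, hve, hde, -⟩ := hvert v hv
    obtain ⟨u, hu, hdu, -⟩ := hedge e
    refine ⟨e.1, e.2, hve, u, hu, ?_⟩
    simp only [hh]
    omega
  have hdist : ∀ v, G.dist r v = h v := fun v =>
    (hasPath_and_dist_eq_of_height hG.vertexSet_eq (by simp [hh, hr0]) hlip hpar v).2
  simp only [hdist]
  refine ⟨fun e he => ?_, by simp [hh, hr0], fun v hv => ?_⟩
  · obtain ⟨u, hu, hdu, hother⟩ := hedge ⟨e, he⟩
    refine ⟨u, hu, fun v hv hvu => ?_⟩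
    have := hother v hv hvu
    simp only [hh]
    omega
  · obtain ⟨e, he, hve, u, hu, hlt⟩ := hpar v hv
    obtain ⟨e', hve', hde', huniq⟩ := hvert v hv
    have key : ∀ f ∈ G.edgeSet, v ∈ f → (∃ u ∈ f, h u + 1 = h v) → f = e'.1 := by
      rintro f hf hvf ⟨u, hu, hlt⟩
      obtain ⟨w, hw, hdw, hother⟩ := hedge ⟨f, hf⟩
      have hvw : v ≠ w := by
        rintro rfl
        by_cases huv : u = v
        · subst huv; omega
        · have := hother u hu huv
          simp only [hh] at hlt
          omega
      exact congrArg Subtype.val (huniq ⟨f, hf⟩ hvf (hother v hvf hvw).symm)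
    refine ⟨e, ⟨he, hve, u, hu, hlt⟩, ?_⟩
    rintro f ⟨hf, hvf, hex⟩
    rw [key f hf hvf hex, key e he hve ⟨u, hu, hlt⟩]

end Hypergraph

/-! ### Every rooted supertree is given by blocks and parents -/

namespace Hypergraph

variable {V : Type*} [Fintype V]

/-- A supertree with a given root is a hypergraph `model P`, up to a numbering that starts at
the root. -/
lemma IsSupertree.exists_model {G : Hypergraph V} {d : ℕ} (hG : G.IsSupertree (d + 1))
    (hd : 1 ≤ d) (r : V) :
    ∃ (m : ℕ) (P : Fin m → Fin (m * d + 1)) (σ : Fin (m * d + 1) ≃ V), Admissible P ∧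
      (model P).image σ = G ∧ σ 0 = r ∧ G.dist r r = 0 ∧
      ∀ j t, G.dist r (σ (slot (j, t))) = G.dist r (σ (P j)) + 1 := by
  classical
  obtain ⟨hedge, hr0, hvert⟩ := hG.dist_structure (by omega) r
  set h := G.dist r with hh
  obtain ⟨m, ⟨ε⟩⟩ : ∃ m, Nonempty (Fin m ≃ G.edgeSet) :=
    ⟨_, ⟨(Finite.equivFin G.edgeSet).symm⟩⟩
  choose p hp hother using fun j => hedge (ε j).1 (ε j).2
  have hcard : ∀ j, Nat.card ((ε j).1 \ {p j} : Set V) = d := by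
    intro j
    rw [Nat.card_coe_set_eq, Set.ncard_sdiff_singleton_of_mem (hp j), hG.uniform _ (ε j).2]
    rfl
  obtain ⟨child⟩ : Nonempty (∀ j, Fin d ≃ ((ε j).1 \ {p j} : Set V)) :=
    ⟨fun j => (Finite.equivFinOfCardEq (hcard j)).symm⟩
  have hchild : ∀ j t, ((child j t : V) ∈ (ε j).1) ∧ (child j t : V) ≠ p j := fun j t =>
    (child j t).2
  have hch_dist : ∀ j t, h (child j t) = h (p j) + 1 := fun j t =>
    hother j _ (hchild j t).1 (hchild j t).2
  have hch_ne : ∀ j t, (child j t : V) ≠ r := by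
    intro j t heq
    have := hch_dist j t
    rw [heq, hr0] at this
    omega
  -- The root gets the number `0`, and the block `j` lists the vertices of the edge `j` other than
  -- the one closest to the root. Every vertex but the root is such a child in exactly one edge, so
  -- this is a bijection.
  set f : Fin (m * d + 1) → V := Fin.cons r fun i =>
    (child (finProdFinEquiv.symm i).1 (finProdFinEquiv.symm i).2 : V) with hf
  have hf0 : f 0 = r := rfl
  have hfslot : ∀ j t, f (slot (j, t)) = child j t := by
    intro j t
    rw [hf, slot, Fin.cons_succ, Equiv.symm_apply_apply]
  have hbij : Function.Bijective f := by
    constructor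
    · intro a b hab
      induction a using slot_cases with
      | zero =>
        induction b using slot_cases with
        | zero => rfl
        | slot q =>
          rw [hf0, ← Prod.mk.eta (p := q), hfslot] at hab
          exact absurd hab.symm (hch_ne _ _)
      | slot q =>
        obtain ⟨j, t⟩ := q
        induction b using slot_cases with
        | zero =>
          rw [hf0, hfslot] at hab
          exact absurd hab (hch_ne _ _)
        | slot q' =>
          obtain ⟨j', t'⟩ := q'
          rw [hfslot, hfslot] at hab
          obtain ⟨e, -, huniq⟩ := hvert _ (hch_ne j t)
          have h1 := huniq _ ⟨(ε j).2, (hchild j t).1, p j, hp j, (hch_dist j t).symm⟩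
          have h2 := huniq _ ⟨(ε j').2, hab ▸ (hchild j' t').1, p j', hp j',
            hab ▸ (hch_dist j' t').symm⟩
          have h3 : j = j' := ε.injective (Subtype.ext (h1.trans h2.symm))
          subst h3
          rw [(child j).injective (Subtype.ext hab)]
    · intro v
      by_cases hv : v = r
      · exact ⟨0, hv.symm⟩
      · obtain ⟨e, ⟨he, hve, u, hu, hlt⟩, -⟩ := hvert v hv
        obtain ⟨j, hj⟩ := ε.surjective ⟨e, he⟩
        have hje : (ε j).1 = e := congrArg Subtype.val hj
        have hvp : v ≠ p j := by
          rintro rfl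
          by_cases hup : u = p j
          · rw [hup] at hlt; omega
          · have := hother j u (hje ▸ hu) hup
            omega
        obtain ⟨t, ht⟩ := (child j).surjective ⟨v, hje ▸ hve, hvp⟩
        exact ⟨slot (j, t), by rw [hfslot, ht]⟩
  set σ := Equiv.ofBijective f hbij with hσ
  set P : Fin m → Fin (m * d + 1) := fun j => σ.symm (p j) with hP
  have hσP : ∀ j, σ (P j) = p j := fun j => σ.apply_symm_apply _
  have hσslot : ∀ j t, σ (slot (j, t)) = child j t := hfslot
  have hblock : ∀ j, σ '' (block P j : Set (Fin (m * d + 1))) = (ε j).1 := by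
    intro j
    ext v
    simp only [Set.mem_image, Finset.mem_coe, mem_block]
    constructor
    · rintro ⟨i, hi | ⟨t, rfl⟩, rfl⟩
      · rw [hi, hσP]; exact hp j
      · rw [hσslot]; exact (hchild j t).1
    · intro hv
      by_cases hvp : v = p j
      · exact ⟨P j, Or.inl rfl, by rw [hσP, hvp]⟩
      · obtain ⟨t, ht⟩ := (child j).surjective ⟨v, hv, hvp⟩
        exact ⟨slot (j, t), Or.inr ⟨t, rfl⟩, by rw [hσslot, ht]⟩
  refine ⟨m, P, σ, ⟨fun j t heq => ?_, fun i j heq => ?_⟩, Hypergraph.ext ?_ ?_, rfl, hr0,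
    fun j t => ?_⟩
  · have := congrArg σ heq
    rw [hσP, hσslot] at this
    exact (hchild j t).2 this.symm
  · refine ε.injective (Subtype.ext ?_)
    rw [← hblock, ← hblock, heq]
  · rw [hG.vertexSet_eq]; simp
  · simp only [image_edgeSet, model_edgeSet, ← Set.range_comp, Function.comp_def, hblock]
    ext e
    constructor
    · rintro ⟨j, rfl⟩; exact (ε j).2
    · intro he
      obtain ⟨j, hj⟩ := ε.surjective ⟨e, he⟩
      exact ⟨j, congrArg Subtype.val hj⟩
  · rw [hσslot, hσP]; exact hch_dist j t

lemma degree_image {V W : Type*} (G : Hypergraph V) (σ : V ≃ W) (v : V) :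
    (G.image σ).degree (σ v) = G.degree v := by
  unfold degree
  symm
  refine Set.ncard_congr (fun e _ => σ '' e) ?_ ?_ ?_
  · rintro e ⟨he, hv⟩
    exact ⟨image_mem_edgeSet_image he, Set.mem_image_of_mem _ hv⟩
  · intro e f _ _ h
    exact σ.injective.image_injective h
  · rintro e ⟨⟨f, hf, rfl⟩, hv⟩
    exact ⟨f, ⟨hf, by simpa using hv⟩, rfl⟩

lemma degreeSequence_image {W : Type*} [Fintype W] (G : Hypergraph V) (σ : V ≃ W) :
    (G.image σ).degreeSequence = G.degreeSequence := by
  unfold degreeSequence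
  rw [← Finset.map_univ_equiv σ, Finset.map_val, Multiset.map_map]
  refine Multiset.map_congr rfl fun v _ => degree_image G σ v

end Hypergraph

/-! ### The extremal hypergraph: supertree, BFS-ordering and degrees -/

namespace Hypergraph

/-- A hypergraph is connected if the graph joining the vertices with a common edge is. -/
lemma isConnected_of_simpleGraph {V : Type*} {G : Hypergraph V} (hV : G.vertexSet = Set.univ)
    {S : SimpleGraph V} (hS : ∀ u v, S.Adj u v ↔ u ≠ v ∧ G.Adj u v) (hc : S.Connected) :
    G.IsConnected := by
  obtain ⟨r⟩ := hc.nonempty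
  refine ⟨⟨r, hV ▸ Set.mem_univ _⟩, fun a _ b _ => ⟨S.dist a b, ?_⟩⟩
  refine (hasPath_and_dist_eq_of_height hV (h := fun v => S.dist a v) (by simp) ?_ ?_ b).1
  · intro e he u hu v hv
    by_cases huv : u = v
    · rw [huv]; omega
    · have h1 : S.Adj u v := (hS u v).2 ⟨huv, e, he, hu, hv⟩
      have h2 := hc.dist_triangle (u := a) (v := u) (w := v)
      rw [SimpleGraph.dist_eq_one_iff_adj.2 h1] at h2
      exact h2
  · intro v hv
    obtain ⟨p, -, hlen⟩ := hc.exists_path_of_dist a v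
    have hnil : ¬ p.Nil := fun h => hv h.eq.symm
    obtain ⟨-, e, he, hu, hve⟩ := (hS _ _).1 (p.adj_penultimate hnil)
    refine ⟨e, he, hve, p.penultimate, hu, ?_⟩
    have h1 := SimpleGraph.dist_le p.dropLast
    have h2 := hc.dist_triangle (u := a) (v := p.penultimate) (w := v)
    rw [SimpleGraph.dist_eq_one_iff_adj.2 (p.adj_penultimate hnil)] at h2
    have h3 : 0 < S.dist a v := hc.pos_dist_of_ne (Ne.symm hv)
    simp only [SimpleGraph.Walk.length_dropLast] at h1
    omega

variable {m d : ℕ}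

/-- At the largest vertex of a cycle, both cycle edges contain a smaller vertex, so the largest
vertex is a child in both. A slot is a child in one block only, so the two edges would coincide. -/
lemma model_isAcyclic {P : Fin m → Fin (m * d + 1)} (hP : ∀ j t, P j < slot (j, t)) :
    (model P).IsAcyclic := by
  rintro l v e ⟨hl, ⟨-, he⟩, hclosed, hv, hinj⟩
  have : Nonempty (Fin l) := ⟨⟨0, by omega⟩⟩
  obtain ⟨i, hi⟩ := Finite.exists_max fun i : Fin l => v i.castSucc
  -- the neighbours of `v i` on the cycle, and its two edges
  obtain ⟨i₀, hne, hi₀⟩ : ∃ i₀ : Fin l, i₀ ≠ i ∧ v i₀.succ = v i.castSucc := by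
    by_cases h0 : i.val = 0
    · refine ⟨⟨l - 1, by omega⟩, fun h => ?_, ?_⟩
      · have := congrArg Fin.val h
        simp only at this
        omega
      · have h1 : (⟨l - 1, by omega⟩ : Fin l).succ = Fin.last l := by
          apply Fin.ext; simp; omega
        have h2 : i.castSucc = 0 := Fin.ext h0
        rw [h1, h2, hclosed]
    · refine ⟨⟨i.val - 1, by omega⟩, fun h => ?_, ?_⟩
      · have := congrArg Fin.val h
        simp only at this
        omega
      · congr 1
        apply Fin.ext; simp; omega
  obtain ⟨i₁, hne₁, hi₁⟩ : ∃ i₁ : Fin l, i₁ ≠ i ∧ v i.succ = v i₁.castSucc := by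
    by_cases h0 : i.val + 1 = l
    · refine ⟨⟨0, by omega⟩, fun h => ?_, ?_⟩
      · have := congrArg Fin.val h
        simp only at this
        omega
      · have h1 : i.succ = Fin.last l := by apply Fin.ext; simp [h0]
        rw [h1, ← hclosed]
        rfl
    · refine ⟨⟨i.val + 1, by omega⟩, fun h => ?_, ?_⟩
      · have := congrArg Fin.val h
        simp only at this
        omega
      · rfl
  have key : ∀ (f : Fin l) (u : Fin (m * d + 1)), v i.castSucc ∈ e f → u ∈ e f →
      u ≤ v i.castSucc → u ≠ v i.castSucc →
      ∃ p, slot p = v i.castSucc ∧ e f = (block P p.1 : Set (Fin (m * d + 1))) := by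
    intro f u hvf huf hle hne
    obtain ⟨a, ha⟩ := (he f).1
    simp only at ha
    rw [← ha, Finset.mem_coe, mem_block] at hvf huf
    rcases hvf with h | ⟨t, ht⟩
    · rcases huf with h' | ⟨t', ht'⟩
      · exact absurd (h'.trans h.symm) hne
      · have := hP a t'
        rw [ht', ← h] at this
        exact absurd this (not_lt.2 hle)
    · exact ⟨(a, t), ht, ha.symm⟩
  obtain ⟨p, hp, hep⟩ := key i (v i.succ) (he i).2.1 (he i).2.2 (hi₁ ▸ hi i₁)
    (by rw [hi₁]; exact fun h => hne₁ (hv h))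
  obtain ⟨p', hp', hep'⟩ := key i₀ (v i₀.castSucc) (hi₀ ▸ (he i₀).2.2) (he i₀).2.1 (hi i₀)
    (fun h => hne (hv h))
  have : p = p' := slot_injective (hp.trans hp'.symm)
  subst this
  exact hne (hinj (hep'.trans hep.symm))

/-- Connectedness comes from descending to smaller and smaller parents until `0` is reached. -/
lemma model_isSupertree {P : Fin m → Fin (m * d + 1)} (hP : ∀ j t, P j < slot (j, t))
    (hd : 1 ≤ d) : (model P).IsSupertree (d + 1) := by
  refine ⟨rfl, (admissible_of_lt_slot hP hd).isUniform, ?_, model_isAcyclic hP⟩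
  set S : SimpleGraph (Fin (m * d + 1)) :=
    { Adj := fun u v => u ≠ v ∧ (model P).Adj u v
      symm := ⟨fun u v h => ⟨h.1.symm, h.2.symm⟩⟩
      loopless := ⟨fun u h => h.1 rfl⟩ } with hS
  refine isConnected_of_simpleGraph rfl (S := S) (fun u v => Iff.rfl) ?_
  have hreach : ∀ (n : ℕ) (i : Fin (m * d + 1)), i.val = n → S.Reachable 0 i := by
    intro n
    induction n using Nat.strong_induction_on with
    | _ n ih =>
      intro i hi
      induction i using slot_cases with
      | zero => exact SimpleGraph.Reachable.refl _
      | slot p =>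
        have h1 : P p.1 < slot p := hP p.1 p.2
        have hadj : S.Adj (P p.1) (slot p) := by
          refine ⟨h1.ne, _, ⟨p.1, rfl⟩, ?_, ?_⟩
          · exact Finset.mem_coe.2 (mem_block.2 (Or.inl rfl))
          · exact Finset.mem_coe.2 (mem_block.2 (Or.inr ⟨p.2, rfl⟩))
        exact (ih _ (hi ▸ h1) _ rfl).trans hadj.reachable
  exact ⟨fun a b => (hreach _ a rfl).symm.trans (hreach _ b rfl)⟩

/-- The heights in the extremal hypergraph. -/
def stdHeight (d s : ℕ) : ℕ → ℕ
  | 0 => 0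
  -- The vertex `i + 1` lies in the block `i / d`, whose parent is `i / d - s`.
  | i + 1 => stdHeight d s (i / d - s) + 1
decreasing_by exact Nat.lt_succ_of_le ((Nat.sub_le _ _).trans (Nat.div_le_self _ _))

lemma stdHeight_mono (d s : ℕ) : Monotone (stdHeight d s) := by
  have : ∀ b a, a ≤ b → stdHeight d s a ≤ stdHeight d s b := by
    intro b
    induction b using Nat.strong_induction_on with
    | _ b ih =>
      intro a hab
      rcases a with _ | a
      · rw [stdHeight]; exact Nat.zero_le _
      · rcases b with _ | b
        · omega
        · rw [stdHeight, stdHeight]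
          have h1 : a / d - s ≤ b / d - s :=
            Nat.sub_le_sub_right (Nat.div_le_div_right (by omega)) s
          have h2 : b / d - s < b + 1 :=
            Nat.lt_succ_of_le ((Nat.sub_le _ _).trans (Nat.div_le_self _ _))
          exact Nat.succ_le_succ (ih _ h2 _ h1)
  exact fun a b h => this b a h

variable {s : ℕ}

lemma stdHeight_slot (hd : 1 ≤ d) (j : Fin m) (t : Fin d) :
    stdHeight d s (slot (j, t)) = stdHeight d s (stdParent m d s j) + 1 := by
  rw [slot_val, stdHeight, stdParent_val hd]
  congr 2
  rw [Nat.mul_add_div (by omega), Nat.div_eq_of_lt t.isLt, add_zero]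

lemma stdHeight_of_mem_block (hd : 1 ≤ d) {j : Fin m} {i : Fin (m * d + 1)}
    (hi : i ∈ block (stdParent m d s) j) :
    i = stdParent m d s j ∨
      (∃ t, slot (j, t) = i) ∧ stdHeight d s i = stdHeight d s (stdParent m d s j) + 1 := by
  rcases mem_block.1 hi with h | ⟨t, rfl⟩
  · exact Or.inl h
  · exact Or.inr ⟨⟨t, rfl⟩, stdHeight_slot hd j t⟩

lemma dist_stdParent (hd : 1 ≤ d) (i : Fin (m * d + 1)) :
    (model (stdParent m d s)).dist 0 i = stdHeight d s i := by
  refine (hasPath_and_dist_eq_of_height rfl (h := fun i : Fin (m * d + 1) => stdHeight d s i)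
    (by simp [stdHeight]) ?_ ?_ i).2
  · rintro _ ⟨j, rfl⟩ u hu v hv
    simp only [Finset.mem_coe] at hu hv ⊢
    rcases stdHeight_of_mem_block hd hu with rfl | ⟨-, h1⟩ <;>
      rcases stdHeight_of_mem_block hd hv with rfl | ⟨-, h2⟩ <;> omega
  · intro v hv
    obtain ⟨p, rfl⟩ := exists_slot_eq hv
    exact ⟨_, ⟨p.1, rfl⟩, Finset.mem_coe.2 (mem_block.2 (Or.inr ⟨p.2, rfl⟩)), stdParent m d s p.1,
      Finset.mem_coe.2 (mem_block.2 (Or.inl rfl)), (stdHeight_slot hd p.1 p.2).symm⟩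

lemma degree_stdParent (hd : 1 ≤ d) (hs : s < m) (i : Fin (m * d + 1)) :
    (model (stdParent m d s)).degree i =
      if i = 0 then s + 1 else if i.val + s < m then 2 else 1 := by
  classical
  rw [(admissible_stdParent hd).degree_model]
  by_cases h0 : i = 0
  · rw [if_pos h0, if_pos h0, h0]
    simp only [stdParent_eq_zero_iff hd, add_zero]
    have : (Finset.univ.filter fun j : Fin m => j.val ≤ s) = Finset.Iic ⟨s, hs⟩ := by
      ext j; simp [Fin.le_def]
    rw [this]
    simp
  · rw [if_neg h0, if_neg h0]
    have h1 : i.val ≠ 0 := fun h => h0 (Fin.ext h)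
    split_ifs with h
    · have : (Finset.univ.filter fun j : Fin m => stdParent m d s j = i) = {⟨i + s, h⟩} := by
        ext j
        simp only [Finset.mem_filter, Finset.mem_univ, true_and, Finset.mem_singleton, Fin.ext_iff,
          stdParent_val hd]
        omega
      rw [this, Finset.card_singleton]
    · have : (Finset.univ.filter fun j : Fin m => stdParent m d s j = i) = ∅ := by
        ext j
        simp only [Finset.mem_filter, Finset.mem_univ, true_and, Fin.ext_iff,
          stdParent_val hd, Finset.notMem_empty, iff_false]
        omega
      rw [this, Finset.card_empty]

lemma degree_stdParent_antitone (hd : 1 ≤ d) (hs₁ : 1 ≤ s) (hs : s < m) :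
    Antitone (model (stdParent m d s)).degree := by
  intro i j hij
  rw [degree_stdParent hd hs, degree_stdParent hd hs]
  have h : i.val ≤ j.val := hij
  simp only [Fin.ext_iff, Fin.val_zero]
  split_ifs <;> omega

/-- The extremal hypergraph is a BFS-supertree. -/
lemma isBFSSupertree_stdParent (hd : 1 ≤ d) (hs₁ : 1 ≤ s) (hs : s < m) :
    (model (stdParent m d s)).IsBFSSupertree (d + 1) := by
  refine ⟨model_isSupertree (stdParent_lt_slot hd) hd, 0, (· < ·), inferInstance, ?_, ?_, ?_, ?_⟩
  · intro u v huv
    rw [dist_stdParent hd, dist_stdParent hd]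
    exact stdHeight_mono d s (le_of_lt huv)
  -- The root has degree `s + 1`, which is at least the degree `2` of the other inner vertices
  -- because `1 ≤ s`.
  · exact fun u v huv => degree_stdParent_antitone hd hs₁ hs huv.le
  · rintro _ ⟨i, rfl⟩ _ ⟨j, rfl⟩ u hu u₁ hu₁ v hv v₁ hv₁ huv hdu hdv
    simp only [Finset.mem_coe, dist_stdParent hd] at hu hu₁ hv hv₁ hdu hdv
    have key : ∀ {j : Fin m} {u u₁ : Fin (m * d + 1)}, u ∈ block (stdParent m d s) j →
        u₁ ∈ block (stdParent m d s) j → stdHeight d s u = stdHeight d s u₁ + 1 →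
        (∃ t, slot (j, t) = u) ∧ u₁ = stdParent m d s j := by
      intro j u u₁ hu hu₁ h
      rcases stdHeight_of_mem_block hd hu with rfl | ⟨ht, h1⟩ <;>
        rcases stdHeight_of_mem_block hd hu₁ with rfl | ⟨-, h2⟩
      · omega
      · omega
      · exact ⟨ht, rfl⟩
      · omega
    obtain ⟨⟨t, rfl⟩, rfl⟩ := key hu hu₁ hdu
    obtain ⟨⟨t', rfl⟩, rfl⟩ := key hv hv₁ hdv
    exact (stdParent_mono hd (fst_le_of_slot_le huv.le)).eq_or_lt
  · rintro _ ⟨j, rfl⟩ a ha b hb ⟨c, hc, hca⟩ v hv ⟨hav, hvb⟩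
    simp only [Finset.mem_coe, mem_block] at ha hb hc hv
    have key : ∀ a, (a = stdParent m d s j ∨ ∃ t, slot (j, t) = a) → c < a →
        ∃ t, slot (j, t) = a := by
      rintro a (rfl | h) hca
      · rcases hc with rfl | ⟨t, rfl⟩
        · exact absurd hca (lt_irrefl _)
        · exact absurd hca (not_lt.2 (stdParent_lt_slot hd j t).le)
      · exact h
    obtain ⟨t, rfl⟩ := key a ha hca
    obtain ⟨t', rfl⟩ := key b hb (hca.trans (hav.trans hvb))
    obtain ⟨p, rfl⟩ := exists_slot_eq (show v ≠ 0 from fun h => by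
      rw [h] at hav; exact absurd hav (not_lt.2 (Fin.zero_le _)))
    -- Blocks are intervals of the numbering, so a vertex between two slots of a block belongs to
    -- it.
    have h1 : p.1 = j := le_antisymm (fst_le_of_slot_le hvb.le) (fst_le_of_slot_le hav.le)
    exact hv (Or.inr ⟨p.2, by rw [← h1]⟩)

lemma map_ite_eq_replicate {ι : Type*} (S : Finset ι) (p : ι → Prop) [DecidablePred p] (a b : ℕ) :
    S.val.map (fun i => if p i then a else b) =
      Multiset.replicate (S.filter p).card a + Multiset.replicate (S.filter fun i => ¬ p i).card b := by
  conv_lhs => rw [← Multiset.filter_add_not p S.val]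
  rw [Multiset.map_add]
  congr 1
  · rw [Multiset.map_congr rfl (g := fun _ => a) (fun i hi => if_pos (Multiset.mem_filter.1 hi).2),
      Multiset.map_const']
    rfl
  · rw [Multiset.map_congr rfl (g := fun _ => b) (fun i hi => if_neg (Multiset.mem_filter.1 hi).2),
      Multiset.map_const']
    rfl

lemma degreeSequence_stdParent (hd : 1 ≤ d) (hs : s < m) :
    (model (stdParent m d s)).degreeSequence =
      (s + 1) ::ₘ (Multiset.replicate (m - 1 - s) 2 +
        Multiset.replicate (m * d - (m - 1 - s)) 1) := by
  have hm : m ≤ m * d := Nat.le_mul_of_pos_right m hd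
  unfold degreeSequence
  rw [Fin.univ_succ, Finset.cons_val, Multiset.map_cons, Finset.map_val, Multiset.map_map]
  congr 1
  · rw [degree_stdParent hd hs, if_pos rfl]
  · rw [Multiset.map_congr rfl (g := fun i : Fin (m * d) => if i.val + 1 + s < m then 2 else 1)
      (fun i _ => by simp [degree_stdParent hd hs]), map_ite_eq_replicate]
    have h1 : (Finset.univ.filter fun i : Fin (m * d) => i.val + 1 + s < m).card = m - 1 - s := by
      rw [← Finset.card_range (m - 1 - s)]
      refine Finset.card_bij (fun i _ => i.val) (fun i hi => ?_) (fun i _ j _ h => Fin.ext h)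
        (fun b hb => ?_)
      · simp only [Finset.mem_filter, Finset.mem_univ, true_and, Finset.mem_range] at hi ⊢
        omega
      · rw [Finset.mem_range] at hb
        exact ⟨⟨b, by omega⟩, by simp; omega, rfl⟩
    have h2 := Finset.card_filter_add_card_filter_not (s := (Finset.univ : Finset (Fin (m * d))))
      (fun i => i.val + 1 + s < m)
    rw [Finset.card_univ, Fintype.card_fin, h1] at h2
    rw [h1]
    congr 2
    omega

end Hypergraph

/-! ### Uniqueness of the BFS-supertree with the extremal degrees -/

lemma eq_of_map_univ_eq_of_monotone {α : Type*} [LinearOrder α] {n : ℕ} {f g : Fin n → α}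
    (hf : Monotone f) (hg : Monotone g)
    (h : (Finset.univ : Finset (Fin n)).val.map f = (Finset.univ : Finset (Fin n)).val.map g) :
    f = g := by
  rw [Fin.univ_val_map, Fin.univ_val_map, Multiset.coe_eq_coe] at h
  exact List.ofFn_injective (h.eq_of_sortedLE hf.sortedLE_ofFn hg.sortedLE_ofFn)

lemma eq_of_map_univ_eq_of_antitone {α : Type*} [LinearOrder α] {n : ℕ} {f g : Fin n → α}
    (hf : Antitone f) (hg : Antitone g)
    (h : (Finset.univ : Finset (Fin n)).val.map f = (Finset.univ : Finset (Fin n)).val.map g) :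
    f = g :=
  eq_of_map_univ_eq_of_monotone (α := αᵒᵈ) hf hg h

/-- A well-order of a finite type is given by a numbering. -/
lemma exists_rank {V : Type*} [Fintype V] {r : V → V → Prop} (hr : IsWellOrder V r) {N : ℕ}
    (hN : Fintype.card V = N) : ∃ rk : V ≃ Fin N, ∀ u v, r u v ↔ rk u < rk v := by
  classical
  let _ : LinearOrder V := linearOrderOfSTO r
  let f := Fintype.orderIsoFinOfCardEq V hN
  refine ⟨f.symm.toEquiv, fun u v => ?_⟩
  exact (f.symm.lt_iff_lt (x := u) (y := v)).symm

namespace Hypergraph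

variable {m d s : ℕ}

/-- By `Admissible.degree_model` the degrees give the multiplicity of every value of `P`, and a
monotone sequence is determined by its multiset of values. -/
lemma eq_stdParent_of_monotone {P : Fin m → Fin (m * d + 1)} (hP : Admissible P) (hd : 1 ≤ d)
    (hmono : Monotone P) (hdeg : (model P).degree = (model (stdParent m d s)).degree) :
    P = stdParent m d s := by
  classical
  refine eq_of_map_univ_eq_of_monotone hmono (fun i j h => stdParent_mono hd h) ?_
  ext i
  have h1 := congrFun hdeg i
  rw [hP.degree_model, (admissible_stdParent hd).degree_model, add_left_inj] at h1
  rw [Multiset.count_map, Multiset.count_map]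
  simp only [eq_comm (a := i)]
  convert h1 using 1 <;>
  rw [← Finset.filter_val, Finset.card_val]

/-- A BFS-supertree with the degrees of the extremal hypergraph is the extremal hypergraph. -/
lemma IsBFSSupertree.isomorphic_stdParent {V : Type*} [Fintype V] {G : Hypergraph V}
    (hG : G.IsBFSSupertree (d + 1)) (hd : 1 ≤ d) (hs₁ : 1 ≤ s) (hs : s < m)
    (hcard : Fintype.card V = m * d + 1)
    (hdeg : G.degreeSequence = (model (stdParent m d s)).degreeSequence) :
    (model (stdParent m d s)).Isomorphic G := by
  obtain ⟨hT, v₀, r, hr⟩ := hG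
  obtain ⟨m', P, σ, hP, hσG, hσ0, hd0, hdist⟩ := hT.exists_model hd v₀
  have hmm : m' = m := by
    have h1 := Fintype.card_congr σ
    rw [Fintype.card_fin, hcard] at h1
    exact Nat.eq_of_mul_eq_mul_right hd (by omega)
  subst hmm
  obtain ⟨rk, hrk⟩ := exists_rank hr.wellOrder hcard
  have hedge : ∀ j, σ '' (block P j : Set (Fin (m' * d + 1))) ∈ G.edgeSet := by
    intro j
    rw [← hσG]
    exact image_mem_edgeSet_image ⟨j, rfl⟩
  have hparent_mem : ∀ j, σ (P j) ∈ σ '' (block P j : Set (Fin (m' * d + 1))) := fun j =>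
    ⟨P j, Finset.mem_coe.2 (mem_block.2 (Or.inl rfl)), rfl⟩
  have hchild_mem : ∀ j t, σ (slot (j, t)) ∈ σ '' (block P j : Set (Fin (m' * d + 1))) :=
    fun j t => ⟨slot (j, t), Finset.mem_coe.2 (mem_block.2 (Or.inr ⟨t, rfl⟩)), rfl⟩
  -- The children are one level further from the root than the parent, so `height_le` excludes the
  -- opposite order.
  have hparent_lt : ∀ j t, r (σ (P j)) (σ (slot (j, t))) := by
    intro j t
    rcases lt_trichotomy (rk (σ (P j))) (rk (σ (slot (j, t)))) with h | h | h
    · exact (hrk _ _).2 h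
    · exact absurd (σ.injective (rk.injective h)) (hP.parent_ne j t)
    · have h1 := hr.height_le _ _ ((hrk _ _).2 h)
      rw [hdist] at h1
      omega
  -- a slot of another block does not lie between two slots of a block
  have hconv : ∀ i j t t' u, i ≠ j → rk (σ (slot (i, t))) < rk (σ (slot (j, u))) →
      rk (σ (slot (j, u))) < rk (σ (slot (i, t'))) → False := by
    intro i j t t' u hij h1 h2
    refine hr.consecutive _ (hedge i) _ (hchild_mem i t) _ (hchild_mem i t')
      ⟨_, hparent_mem i, hparent_lt i t⟩ (σ (slot (j, u))) ?_ ⟨(hrk _ _).2 h1, (hrk _ _).2 h2⟩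
    rintro ⟨a, ha, haσ⟩
    rw [σ.injective haσ, Finset.mem_coe, mem_block] at ha
    rcases ha with ha | ⟨t'', ha⟩
    · have h3 := (hrk _ _).1 (hparent_lt i t)
      rw [← ha] at h3
      exact absurd h1 (not_lt.2 h3.le)
    · exact hij (congrArg Prod.fst (slot_injective ha))
  -- Negated ranks turn the BFS-ordering into a decreasing vector, so that the sorting lemma for
  -- blocks applies. Any two blocks are comparable: their slots by `consecutive`, their parents by
  -- `parent_le`.
  set y : Fin m' → ℝ := fun j => -((rk (σ (P j))).val : ℝ) with hy
  set z : Fin m' × Fin d → ℝ := fun p => -((rk (σ (slot p))).val : ℝ) with hz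
  have hle : ∀ {a b : Fin (m' * d + 1)}, -((a.val : ℕ) : ℝ) ≤ -((b.val : ℕ) : ℝ) ↔ b ≤ a := by
    intro a b
    rw [neg_le_neg_iff, Nat.cast_le, Fin.le_def]
  obtain ⟨π, ρ, hy', hz'⟩ := exists_sorted_of_dominates (y := y) (z := z)
    (fun j => z (j, ⟨0, hd⟩)) (by
      intro i j hij hA
      simp only [hz, hle] at hA
      have hne : ∀ t t', rk (σ (slot (i, t))) ≠ rk (σ (slot (j, t'))) := fun t t' h =>
        hij (congrArg Prod.fst (slot_injective (σ.injective (rk.injective h))))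
      have hlt := lt_of_le_of_ne hA (hne _ _)
      refine ⟨?_, fun t t' => ?_⟩
      · simp only [hy, hle]
        rcases hr.parent_le _ (hedge i) _ (hedge j) _ (hchild_mem i ⟨0, hd⟩) _ (hparent_mem i) _
          (hchild_mem j ⟨0, hd⟩) _ (hparent_mem j) ((hrk _ _).2 hlt) (hdist _ _) (hdist _ _) with h | h
        · rw [h]
        · exact ((hrk _ _).1 h).le
      · simp only [hz, hle]
        have h1 : rk (σ (slot (i, t))) < rk (σ (slot (j, ⟨0, hd⟩))) := by
          by_contra hc
          exact hconv i j _ t _ hij hlt (lt_of_le_of_ne (not_lt.1 hc) (hne _ _).symm)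
        by_contra hc
        exact hconv j i t' _ t hij.symm (not_le.1 hc) h1)
  set τ := (liftPerm (Equiv.prodShear π ρ)).trans σ with hτ
  have hτG : (model (relabel π ρ P)).image τ = G := by
    rw [← image_relabel, image_image, ← hσG]
    congr 1
    funext i
    simp [hτ]
  -- A monotone bijection of `Fin (m' * d + 1)` is the identity, so after renumbering the BFS-rank
  -- is the vertex number itself.
  have hid : ∀ i, rk (τ i) = i := by
    have hmono : Monotone fun i => rk (τ i) := by
      have : Antitone fun i => -((rk (τ i)).val : ℝ) := by
        refine antitone_of_slot (fun i => ?_) ?_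
        · rw [hle]
          have h0 : τ 0 = v₀ := by simp [hτ, hσ0]
          rw [h0]
          by_contra hc
          have h1 := hr.height_le _ _ ((hrk _ _).2 (not_le.1 hc))
          obtain ⟨a, ha⟩ := σ.surjective (τ i)
          rw [← ha] at h1 hc
          induction a using slot_cases with
          | zero => exact hc (hσ0 ▸ le_rfl)
          | slot p =>
            have h2 := hdist p.1 p.2
            simp only [Prod.mk.eta] at h2
            omega
        · simpa only [hz, hτ, Equiv.trans_apply, liftPerm_slot] using hz'
      exact fun a b hab => hle.1 (this hab)
    have hst : StrictMono fun i => rk (τ i) :=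
      hmono.strictMono_of_injective (rk.injective.comp τ.injective)
    intro i
    have := Subsingleton.elim (hst.orderIsoOfSurjective _ (rk.surjective.comp τ.surjective))
      (OrderIso.refl _)
    exact congrArg (fun f : Fin (m' * d + 1) ≃o Fin (m' * d + 1) => f i) this
  have hPmono : Monotone (relabel π ρ P) := by
    intro a b hab
    rw [← hid (relabel π ρ P a), ← hid (relabel π ρ P b)]
    have := hy' hab
    simp only [Function.comp, hy, hle] at this
    simpa [hτ, relabel] using this
  have hPstd : relabel π ρ P = stdParent m' d s := by
    refine eq_stdParent_of_monotone (admissible_relabel hP π ρ) hd hPmono ?_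
    refine eq_of_map_univ_eq_of_antitone ?_ (degree_stdParent_antitone hd hs₁ hs) ?_
    · intro a b hab
      rcases hab.eq_or_lt with rfl | hlt
      · exact le_rfl
      · rw [← degree_image _ τ a, ← degree_image _ τ b, hτG]
        exact hr.degree_ge _ _ ((hrk _ _).2 (by rwa [hid, hid]))
    · change (model (relabel π ρ P)).degreeSequence = _
      rw [← degreeSequence_image _ τ, hτG, hdeg]
      rfl
  exact hPstd ▸ ⟨τ, hτG⟩

end Hypergraph

/-! ### The extremal theorem -/

namespace Hypergraph

lemma numPendent_eq_count {V : Type*} [Fintype V] {G : Hypergraph V}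
    (hV : G.vertexSet = Set.univ) : G.numPendent = G.degreeSequence.count 1 := by
  classical
  unfold numPendent degreeSequence
  rw [Multiset.count_map, ← Finset.filter_val, Finset.card_val, ← Set.ncard_coe_finset]
  congr 1
  ext v
  simp [hV, eq_comm]

lemma IsPerron.image {V W : Type*} [Fintype V] [Fintype W] {G : Hypergraph V} {k : ℕ} {M : ℝ}
    {x : V → ℝ} (h : G.IsPerron k M x) (σ : V ≃ W) :
    (G.image σ).IsPerron k M (x ∘ σ.symm) where
  nonneg v := h.nonneg _
  sum_pow := (Equiv.sum_comp σ.symm fun v => x v ^ k).trans h.sum_pow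
  form_eq := by
    rw [form_image, Function.comp_assoc, Equiv.symm_comp_self, Function.comp_id, h.form_eq]
  form_le y hy := by
    rw [form_image, ← Equiv.sum_comp σ]
    exact h.form_le _ fun v => hy _

variable {m d s : ℕ}

/-- The equations involve the parents only through their values inside the edge products, so the
products may be taken from `Q`. Thus two hypergraphs are compared with the same weights. -/
lemma IsPerron.balanced {P Q : Fin m → Fin (m * d + 1)} {k : ℕ} {M : ℝ}
    {x : Fin (m * d + 1) → ℝ} (h : (model P).IsPerron k M x) (hk : 1 ≤ k) (hP : Admissible P)
    (hPQ : ∀ j, x (P j) = x (Q j)) : Balanced k M x (edgeProd Q x) P := by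
  classical
  have he : edgeProd Q x = edgeProd P x := by
    funext j
    rw [edgeProd, edgeProd, hPQ]
  intro i
  rw [he, ← h.eq hk i]
  convert (hP.sum_edges x k i).symm

/-- The count leaves `m - s` vertices that are not pendent, and each of them is the root or the
parent of some block. -/
lemma card_image_parent {P : Fin m → Fin (m * d + 1)} (hP : Admissible P)
    (hcount : (model P).numPendent + m = m * d + 1 + s) :
    m ≤ ((Finset.univ.image P).erase 0).card + 1 + s := by
  classical
  have h1 : (Finset.univ.filter fun i => (model P).degree i = 1).card = (model P).numPendent := by
    unfold numPendent
    rw [← Set.ncard_coe_finset]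
    congr 1
    ext v
    simp
  have h2 := Finset.card_filter_add_card_filter_not (s := (Finset.univ : Finset (Fin (m * d + 1))))
    (fun i => (model P).degree i = 1)
  rw [Finset.card_univ, Fintype.card_fin] at h2
  have h3 : (Finset.univ.filter fun i => ¬ (model P).degree i = 1) ⊆
      insert 0 ((Finset.univ.image P).erase 0) := by
    intro i hi
    rw [Finset.mem_insert, Finset.mem_erase]
    by_cases h0 : i = 0
    · exact Or.inl h0
    · refine Or.inr ⟨h0, ?_⟩
      by_contra hc
      refine (Finset.mem_filter.1 hi).2 ?_
      rw [hP.degree_model, if_neg h0, Finset.card_eq_zero.2, zero_add]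
      rw [Finset.filter_eq_empty_iff]
      exact fun j _ hj => hc (Finset.mem_image.2 ⟨j, Finset.mem_univ j, hj⟩)
  have h4 := (Finset.card_le_card h3).trans (Finset.card_insert_le _ _)
  omega

/-- Among the supertrees with a given number of pendent vertices, the extremal hypergraph has the
largest signless Laplacian spectral radius, and it is the only one. -/
lemma IsSupertree.signlessRadius_le_stdParent {V : Type*} [Fintype V] {H : Hypergraph V}
    (hH : H.IsSupertree (d + 1)) (hd : 1 ≤ d) (hs : s < m)
    (hcard : Fintype.card V = m * d + 1) (hpend : H.numPendent + m = m * d + 1 + s) :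
    H.signlessRadius (d + 1) ≤ (model (stdParent m d s)).signlessRadius (d + 1) ∧
      (H.signlessRadius (d + 1) = (model (stdParent m d s)).signlessRadius (d + 1) →
        H.Isomorphic (model (stdParent m d s))) := by
  obtain ⟨x, hx, hpos⟩ := hH.exists_isPerron (by omega)
  have : Nonempty V := Fintype.card_pos_iff.1 (by omega)
  -- The root is put where the Perron vector is largest, so that sorting the slots alone sorts the
  -- whole vector.
  obtain ⟨v₀, hv₀⟩ := Finite.exists_max x
  obtain ⟨m', P, σ, hP, hσH, hσ0, -, -⟩ := hH.exists_model hd v₀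
  have hmm : m' = m := by
    have h1 := Fintype.card_congr σ
    rw [Fintype.card_fin, hcard] at h1
    exact Nat.eq_of_mul_eq_mul_right hd (by omega)
  subst hmm
  have hstd : (model (stdParent m' d s)).IsSupertree (d + 1) :=
    model_isSupertree (stdParent_lt_slot hd) hd
  obtain ⟨y, hy, -⟩ := hstd.exists_isPerron (by omega)
  have hmodel : H.image σ.symm = model P := by
    rw [← hσH, image_image, Equiv.symm_comp_self]
    simp [Hypergraph.ext_iff]
  have hx' := hx.image σ.symm
  rw [hmodel, Equiv.symm_symm] at hx'
  have hpend' : (model P).numPendent + m' = m' * d + 1 + s := by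
    rw [← hpend, numPendent_eq_count hH.vertexSet_eq, numPendent_eq_count rfl, ← hσH,
      degreeSequence_image]
  obtain ⟨e, hle, heq⟩ := hP.form_le_stdParent hd (admissible_stdParent hd) (x := x ∘ σ)
    (fun i => hpos _) (fun i => by simpa [hσ0] using hv₀ (σ i)) (card_image_parent hP hpend') (k := d + 1) (by omega)
  rw [hx'.form_eq] at hle heq
  have hsum : ∑ i, ((x ∘ σ) ∘ e) i ^ (d + 1) = 1 :=
    (Equiv.sum_comp e fun i => (x ∘ σ) i ^ (d + 1)).trans hx'.sum_pow
  have hle' := hy.form_le ((x ∘ σ) ∘ e) fun i => (hpos _).le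
  rw [hsum, mul_one] at hle'
  refine ⟨hle.trans hle', fun hE => ?_⟩
  obtain ⟨hanti, π, ρ, hlift, hpar⟩ := heq (hle.antisymm (hle'.trans_eq hE.symm))
  -- With equal radii the sorted vector attains the maximum for the extremal hypergraph as well, so
  -- it is a Perron vector of both hypergraphs.
  have hP1 : (model (stdParent m' d s)).IsPerron (d + 1)
      ((model (stdParent m' d s)).signlessRadius (d + 1)) ((x ∘ σ) ∘ e) :=
    ⟨fun i => (hpos _).le, hsum, hle'.antisymm (hE.symm.trans_le hle), hy.form_le⟩
  have hP2 := hx'.image (liftPerm (Equiv.prodShear π ρ)).symm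
  rw [image_relabel, Equiv.symm_symm, hlift, hE] at hP2
  have hiso := isomorphic_stdParent_of_balanced hd hs (fun i => hpos _) hanti
    (hP1.balanced (by omega) (admissible_stdParent hd) fun _ => rfl) m' (relabel π ρ P)
    (hP2.balanced (by omega) (admissible_relabel hP π ρ) hpar) hpar (fun i hi => by omega)
  have hHP : H.Isomorphic (model P) := ⟨σ.symm, hmodel⟩
  exact hHP.trans ((isomorphic_relabel π ρ P).trans hiso)

end Hypergraph

theorem theorem4p10 (k n q : ℕ) (hk : 2 ≤ k) (hdvd : k - 1 ∣ n - 1)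
    (hq₁ : n + 1 ≤ q + (n - 1) / (k - 1)) (hq₂ : q ≤ n - 1) :
    (∃ G : Hypergraph (Fin n), G.IsBFSSupertree k ∧ G.degreeSequence = extremalDegrees n q k) ∧
    ∀ G : Hypergraph (Fin n), G.IsBFSSupertree k → G.degreeSequence = extremalDegrees n q k →
      G ∈ supertreesWithPendent n q k ∧
      ∀ H ∈ supertreesWithPendent n q k,
        H.signlessRadius k ≤ G.signlessRadius k ∧
        (H.signlessRadius k = G.signlessRadius k ↔ H.Isomorphic G) := by
  obtain ⟨d, rfl⟩ : ∃ d, k = d + 1 := ⟨k - 1, by omega⟩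
  have hd : 1 ≤ d := by omega
  rw [Nat.add_sub_cancel] at hdvd hq₁
  obtain ⟨m, hm⟩ := hdvd
  obtain ⟨n, rfl⟩ : ∃ l, n = l + 1 := by
    -- For `n = 0` the bounds would require `1 ≤ q` and `q ≤ 0`.
    rcases n with _ | l
    · simp only [Nat.zero_sub, Nat.zero_div] at hq₁ hq₂
      omega
    · exact ⟨l, rfl⟩
  rw [Nat.add_sub_cancel, mul_comm] at hm
  subst hm
  rw [Nat.add_sub_cancel, Nat.mul_div_cancel _ hd] at hq₁
  rw [Nat.add_sub_cancel] at hq₂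
  -- `s + 1` is the first entry `q + 1 + m - n` of the degree sequence, with `m` the number of
  -- edges. The bounds on `q` are equivalent to `1 ≤ s` and `s < m`.
  obtain ⟨s, hs⟩ : ∃ s, q + m = m * d + 1 + s := ⟨q + m - (m * d + 1), by omega⟩
  have hs₁ : 1 ≤ s := by omega
  have hsm : s < m := by omega
  have hext : extremalDegrees (m * d + 1) q (d + 1) =
      (Hypergraph.model (Hypergraph.stdParent m d s)).degreeSequence := by
    rw [Hypergraph.degreeSequence_stdParent hd hsm, extremalDegrees, Nat.add_sub_cancel, Nat.add_sub_cancel,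
      Nat.mul_div_cancel _ hd]
    congr 3 <;> omega
  have hcount : (extremalDegrees (m * d + 1) q (d + 1)).count 1 = q := by
    rw [extremalDegrees, Nat.add_sub_cancel, Nat.add_sub_cancel, Nat.mul_div_cancel _ hd,
      Multiset.count_cons_of_ne (by omega), Multiset.count_add, Multiset.count_replicate,
      Multiset.count_replicate]
    simp
  refine ⟨⟨_, Hypergraph.isBFSSupertree_stdParent hd hs₁ hsm, hext.symm⟩, fun G hG hdeg => ?_⟩
  have hiso := hG.isomorphic_stdParent hd hs₁ hsm (Fintype.card_fin _) (hdeg.trans hext)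
  have hstd : (Hypergraph.model (Hypergraph.stdParent m d s)).IsSupertree (d + 1) :=
    Hypergraph.model_isSupertree (Hypergraph.stdParent_lt_slot hd) hd
  have hrad := hiso.signlessRadius_eq hk hstd hG.1
  refine ⟨⟨hG.1, by rw [Hypergraph.numPendent_eq_count hG.1.vertexSet_eq, hdeg, hcount]⟩, ?_⟩
  rintro H ⟨hH, hHq⟩
  obtain ⟨hle, heq⟩ := hH.signlessRadius_le_stdParent hd hsm (Fintype.card_fin _) (hHq ▸ hs)
  rw [← hrad]
  exact ⟨hle, fun h => (heq h).trans hiso,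
    fun h => (h.signlessRadius_eq hk hH hG.1).trans hrad.symm⟩

end
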